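/- Let $2<\beta<3$ and $w>5.88$, and put $\alpha=\frac{\beta-2}{\beta-1}$. For $n\ge 1$ and $w_{\max}>0$ let $$c=\alpha\, w\, n^{1/(\beta-1)},\qquad i_0=n\Big(\frac{\alpha w}{w_{\max}}\Big)^{\beta-1},\qquad w_i=c\,i^{-1/(\beta-1)}\quad (i=i_0,\,i_0+1,\dots,i_0+n-1),$$ so that the largest weight is $w_{\max}$. Here $w_{\max}=w_{\max}(n)$ may depend on $n$; it is assumed that $w_{\max}(n)\to\infty$ (so that the average weight is $w(1+o(1))$) and that $\max_i w_i^2<\sum_k w_k$ for all large $n$. Let $G(\mathbf w)$ be the random graph on these $n$ nodes in which the edges $\{i,j\}$ (loops $i=j$ allowed, a loop contributing $1$ to the degree) are present independently with probability $w_iw_j/\sum_k w_k$. For a graph with adjacency matrix $A$ and a set $S$ of nodes let $d(S)=\sum_{i\in S}\sum_j A_{ij}$, let $e(S,\bar S)=\sum_{i\in S,\,j\notin S}A_{ij}$, and let $\phi(S)=e(S,\bar S)/\min\{d(S),d(\bar S)\}$ be the conductance of $S$; call $S$ connected if it is non-empty and the subgraph that it induces is connected. Then there are constants $a_1,a_2,b_1,b_2,c',\varepsilon>0$,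 depending only on $\beta$ and $w$, such that for every such choice of $w_{\max}(n)$, with probability tending to $1$ as $n\to\infty$, the following two statements both hold for $G(\mathbf w)$. 1. There is a connected set $S$ of nodes, joined to its complement by exactly one edge (a whisker), with $a_1\log n\le |S|\le a_2\log n$ and $\dfrac{b_1}{\log n}\le\phi(S)\le\dfrac{b_2}{\log n}$. 2. Every connected set $S$ of nodes with $|S|>c'\log n$ and $d(S)\le\frac12 d(V)$, where $V$ is the set of all nodes, satisfies $\phi(S)\ge\varepsilon$. -/

import Mathlib

open MeasureTheory ProbabilityTheory Filter Topology

noncomputable section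

/-! ### The random graph with given expected degrees -/

/-- A graph on `Fin n`, loops allowed, as the indicator of its set of edges (unordered pairs;
the diagonal pairs are the possible loops). -/
abbrev EdgeConfig (n : ℕ) : Type := Sym2 (Fin n) → Bool

/-- The edge probability `w_i * w_j / ∑ k, w_k` of an unordered pair `{i, j}`. -/
def edgeProb {n : ℕ} (w : Fin n → ℝ) : Sym2 (Fin n) → ℝ :=
  Sym2.lift ⟨fun i j => w i * w j / ∑ k, w k, fun i j => congrArg (· / ∑ k, w k) (mul_comm (w i) (w j))⟩

/-- The law of the random graph `G(w)`: the edges are independent, and the pair `{i, j}` is an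
edge with probability `w_i * w_j / ∑ k, w_k`. The projection to `[0, 1]` has no effect when
`w ≥ 0` and `w_i ^ 2 < ∑ k, w_k` for all `i`. -/
def expectedDegreeGraph {n : ℕ} (w : Fin n → ℝ) : Measure (EdgeConfig n) :=
  Measure.pi fun e =>
    bernoulliMeasure true false (Set.projIcc (0 : ℝ) 1 zero_le_one (edgeProb w e))

/-! ### The power-law expected degree sequence -/

/-- `α = (β - 2) / (β - 1)`. -/
def powerLawAlpha (β : ℝ) : ℝ := (β - 2) / (β - 1)

/-- `c = α * w * n ^ (1 / (β - 1))`. -/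
def powerLawCoeff (β w : ℝ) (n : ℕ) : ℝ :=
  powerLawAlpha β * w * (n : ℝ) ^ (1 / (β - 1))

/-- `i₀ = n * (α * w / wmax) ^ (β - 1)`. -/
def powerLawShift (β w wmax : ℝ) (n : ℕ) : ℝ :=
  n * (powerLawAlpha β * (w / wmax)) ^ (β - 1)

/-- The weights `w_i = c * i ^ (-1 / (β - 1))` for `i = i₀, i₀ + 1, …, i₀ + n - 1`; the node
`j : Fin n` carries the index `i = i₀ + j`. -/
def powerLawWeight (β w wmax : ℝ) (n : ℕ) (j : Fin n) : ℝ :=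
  powerLawCoeff β w n * (powerLawShift β w wmax n + (j : ℕ)) ^ (-1 / (β - 1))

/-! ### Cuts, volumes, conductance -/

/-- The entries of the adjacency matrix. -/
def adjEntry {n : ℕ} (G : EdgeConfig n) (i j : Fin n) : ℕ := if G s(i, j) then 1 else 0

/-- The number of edges between `S` and its complement. -/
def cutSize {n : ℕ} (G : EdgeConfig n) (S : Finset (Fin n)) : ℕ :=
  ∑ i ∈ S, ∑ j ∈ Sᶜ, adjEntry G i j

/-- The volume of `S`: the sum of the actual degrees of the nodes in `S`. -/
def volumeOf {n : ℕ} (G : EdgeConfig n) (S : Finset (Fin n)) : ℕ :=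
  ∑ i ∈ S, ∑ j, adjEntry G i j

/-- The conductance of `S`. -/
def conductance {n : ℕ} (G : EdgeConfig n) (S : Finset (Fin n)) : ℝ :=
  (cutSize G S : ℝ) / (min (volumeOf G S) (volumeOf G Sᶜ) : ℕ)

/-- The simple graph obtained by forgetting the loops. -/
def underlyingGraph {n : ℕ} (G : EdgeConfig n) : SimpleGraph (Fin n) :=
  SimpleGraph.fromEdgeSet {e | G e = true}

/-- `S` is connected: it is non-empty and the subgraph that it induces is connected. -/
def IsConnectedSet {n : ℕ} (G : EdgeConfig n) (S : Finset (Fin n)) : Prop :=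
  ((underlyingGraph G).induce (S : Set (Fin n))).Connected

/-- `S` is a connected set that is attached to the rest of the graph by a single edge. -/
def IsWhisker {n : ℕ} (G : EdgeConfig n) (S : Finset (Fin n)) : Prop :=
  IsConnectedSet G S ∧ cutSize G S = 1

end

/-!
Both statements are proved by moment computations, for which the law of a product of functions
of single edges is all that is needed (`integral_prod_edges`). Write `x` for the sum of the weights
in `S` and `W` for the sum of all weights; `W ≥ 5.88 n` for large `n`.

*Large connected sets have large conductance.* If the conductance is small then `S` has far fewer
boundary edges than expected, namely `x (W - x) / W`, or it has an unexpected number of inner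
edges; a Chernoff bound with a small exponential tilt inside `S` and a large one across the cut
handles both at once (`integral_prod_mul_exp_cut_le`). If `x ≥ W / 5`, the resulting bound
`exp (-0.15 W)` beats the number `2 ^ n` of all sets, and connectivity is not used
(`measureReal_isLowCut_le`); for `x > W / 2` one gains from the fact that the smaller inner volume
is that of `S`. If `x ≤ W / 5`, connectivity is charged: each node of `S` other than a root has a
parent, the edges to the parents are distinct (`exists_parent`), and a sum over all parent functions
gives the bound `∏ (1.01 w_i x / W) * exp (-0.79 x)`. Maximized over the weights this is
`(6.5 m / (e ^ 2 W)) ^ m` for `m + 1` nodes, and the number of sets with `m + 1` nodes is at most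
`n (e n / m) ^ m`; as `6.5 / (5.88 e) < 1 / 2`, the expected number of bad sets with `m + 1` nodes is
at most `n 2 ^ (-m)` (`sum_powersetCard_le`).

*Whiskers.* Consider paths of `m + 1` nodes of bounded weight, the first of which is joined to an
anchor outside, with no other edge at any of them. For `m` close to a small multiple of `log n` the
expected number of such paths is at least of order `√n`. Two different ones cannot overlap
(`HangingPath.eq_of_not_disjoint`), and disjoint ones are nearly independent
(`HangingPath.measureReal_inter_le`), so by Chebyshev's inequality at least two of them occur
(`measureReal_forall_eq_le`). The second one ensures that the complement of the first has
sufficient volume, so that the conductance is the reciprocal of the volume of the path.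
-/

/-! ### Expectations of products over the edges -/

/-- The number of ordered pairs that represent an unordered one: `1` for a loop, `2` otherwise. -/
def pairMultiplicity {n : ℕ} (e : Sym2 (Fin n)) : ℕ :=
  (Finset.univ.filter fun p : Fin n × Fin n => s(p.1, p.2) = e).card

lemma pairMultiplicity_eq_one_or_two {n : ℕ} (e : Sym2 (Fin n)) :
    pairMultiplicity e = 1 ∨ pairMultiplicity e = 2 := by
  induction e with
  | _ a b =>
    have h : (Finset.univ.filter fun p : Fin n × Fin n => s(p.1, p.2) = s(a, b))
        = {(a, b), (b, a)} := by
      ext ⟨x, y⟩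
      simp
    unfold pairMultiplicity
    rw [h]
    by_cases hab : a = b
    · left
      simp [hab]
    · right
      rw [Finset.card_pair]
      simp [hab]

lemma sum_sum_sym2 {n : ℕ} (g : Sym2 (Fin n) → ℝ) :
    ∑ i, ∑ j, g s(i, j) = ∑ e, (pairMultiplicity e : ℝ) * g e := by
  rw [← Finset.sum_product', Finset.univ_product_univ,
    ← Finset.sum_fiberwise Finset.univ (fun p : Fin n × Fin n => s(p.1, p.2))]
  refine Finset.sum_congr rfl fun e _ => ?_
  rw [Finset.sum_congr rfl (g := fun _ => g e)]
  · simp [pairMultiplicity]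
  · intro p hp
    rw [(Finset.mem_filter.1 hp).2]

@[simp]
lemma edgeProb_mk {n : ℕ} (w : Fin n → ℝ) (i j : Fin n) :
    edgeProb w s(i, j) = w i * w j / ∑ k, w k := rfl

lemma edgeProb_nonneg {n : ℕ} {w : Fin n → ℝ} (hw : ∀ i, 0 < w i) (e : Sym2 (Fin n)) :
    0 ≤ edgeProb w e := by
  induction e with
  | _ a b =>
    rw [edgeProb_mk]
    exact div_nonneg (mul_pos (hw a) (hw b)).le (Finset.sum_nonneg fun i _ => (hw i).le)

lemma edgeProb_le_one {n : ℕ} {w : Fin n → ℝ} (hw2 : ∀ i, w i ^ 2 < ∑ k, w k) (e : Sym2 (Fin n)) : edgeProb w e ≤ 1 := by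
  induction e with
  | _ a b =>
    rw [edgeProb_mk, div_le_one (lt_of_le_of_lt (sq_nonneg _) (hw2 a))]
    nlinarith [hw2 a, hw2 b, sq_nonneg (w a - w b)]

instance {n : ℕ} (w : Fin n → ℝ) : IsProbabilityMeasure (expectedDegreeGraph w) := by
  unfold expectedDegreeGraph
  infer_instance

/-- Independence of the edges, in the form of the expectation of a product. -/
lemma integral_prod_edges {n : ℕ} {w : Fin n → ℝ} (hw : ∀ i, 0 < w i)
    (hw2 : ∀ i, w i ^ 2 < ∑ k, w k) (f : Sym2 (Fin n) → Bool → ℝ) :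
    ∫ G, ∏ e, f e (G e) ∂(expectedDegreeGraph w)
      = ∏ e, (edgeProb w e * f e true + (1 - edgeProb w e) * f e false) := by
  unfold expectedDegreeGraph
  rw [integral_fintype_prod_eq_prod (f := f)]
  refine Finset.prod_congr rfl fun e _ => ?_
  rw [integral_bernoulliMeasure, Set.projIcc_of_mem zero_le_one
    ⟨edgeProb_nonneg hw e, edgeProb_le_one hw2 e⟩]
  simp

/-- Chernoff bound for weighted edge counts, on the event that the edges in `F` are present.
Loops do no harm since `u - 1 ≤ (u ^ 2 - 1) / 2`. -/
lemma integral_prod_mul_exp_le {n : ℕ} {w : Fin n → ℝ} (hw : ∀ i, 0 < w i)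
    (hw2 : ∀ i, w i ^ 2 < ∑ k, w k) (θ : Sym2 (Fin n) → ℝ) (F : Finset (Sym2 (Fin n)))
    (hθ : ∀ e ∈ F, 0 ≤ θ e) :
    ∫ G, (∏ e ∈ F, if G e then 1 else 0) * Real.exp (∑ i, ∑ j, θ s(i, j) * adjEntry G i j)
        ∂(expectedDegreeGraph w)
      ≤ (∏ e ∈ F, edgeProb w e * Real.exp (2 * θ e))
        * Real.exp ((∑ i, ∑ j, edgeProb w s(i, j) * (Real.exp (2 * θ s(i, j)) - 1)) / 2) := by
  obtain ⟨f, hf⟩ : ∃ f : Sym2 (Fin n) → Bool → ℝ, ∀ e b, f e b =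
      (if e ∈ F then (if b then (1 : ℝ) else 0) else 1)
        * (if b then Real.exp (pairMultiplicity e * θ e) else 1) := ⟨_, fun _ _ => rfl⟩
  have h1 : ∀ G : EdgeConfig n,
      (∏ e ∈ F, if G e then (1 : ℝ) else 0) * Real.exp (∑ i, ∑ j, θ s(i, j) * adjEntry G i j)
      = ∏ e, f e (G e) := by
    intro G
    simp_rw [hf]
    rw [Finset.prod_mul_distrib, Finset.prod_ite_mem, Finset.univ_inter]
    congr 1
    have := sum_sum_sym2 (fun e => θ e * if G e then 1 else 0)
    simp only [adjEntry, Nat.cast_ite, Nat.cast_one, Nat.cast_zero]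
    rw [this, Real.exp_sum]
    refine Finset.prod_congr rfl fun e _ => ?_
    split_ifs <;> simp
  rw [integral_congr_ae (ae_of_all _ h1), integral_prod_edges hw hw2 f, sum_sum_sym2 (fun e => edgeProb w e * (Real.exp (2 * θ e) - 1)),
    Finset.sum_div, Real.exp_sum, ← Finset.univ_inter F, ← Finset.prod_ite_mem,
    ← Finset.prod_mul_distrib]
  have key : ∀ e, Real.exp (pairMultiplicity e * θ e) - 1
      ≤ pairMultiplicity e * (Real.exp (2 * θ e) - 1) / 2 := by
    intro e
    have h2 : Real.exp (2 * θ e) = Real.exp (θ e) ^ 2 := by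
      rw [← Real.exp_nat_mul]
      simp
    rw [h2]
    rcases pairMultiplicity_eq_one_or_two e with h | h <;> rw [h]
    · norm_num
      nlinarith [sq_nonneg (Real.exp (θ e) - 1)]
    · push_cast
      rw [h2]
      linarith
  simp_rw [hf]
  refine Finset.prod_le_prod (fun e _ => ?_) (fun e _ => ?_)
  · have h3 := edgeProb_nonneg hw e
    have h4 := edgeProb_le_one hw2 e
    have : 0 ≤ 1 - edgeProb w e := by linarith
    by_cases he : e ∈ F <;> simp only [he, if_true, if_false] <;> simp <;> positivity
  · have h3 := edgeProb_nonneg hw e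
    by_cases he : e ∈ F <;> simp only [he, if_true, if_false]
    · have h0 := hθ e he
      have h5 : Real.exp (pairMultiplicity e * θ e) ≤ Real.exp (2 * θ e) := by
        apply Real.exp_le_exp.2
        rcases pairMultiplicity_eq_one_or_two e with h | h <;> rw [h] <;> push_cast <;> linarith
      have h6 : 1 ≤ Real.exp (pairMultiplicity e
          * (edgeProb w e * (Real.exp (2 * θ e) - 1)) / 2) := by
        apply Real.one_le_exp
        have : 0 ≤ Real.exp (2 * θ e) - 1 := by
          linarith [Real.one_le_exp (x := 2 * θ e) (by linarith)]
        positivity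
      have h7 : edgeProb w e * Real.exp (pairMultiplicity e * θ e)
          ≤ edgeProb w e * Real.exp (2 * θ e) := mul_le_mul_of_nonneg_left h5 h3
      have h8 : 0 ≤ edgeProb w e * Real.exp (2 * θ e) := by positivity
      simp
      nlinarith
    · have h9 := Real.add_one_le_exp (pairMultiplicity e
          * (edgeProb w e * (Real.exp (2 * θ e) - 1)) / 2)
      have h10 := mul_le_mul_of_nonneg_left (key e) h3
      simp
      linarith

/-! ### Degree counts on the two sides of a cut -/

/-- The sum of the degrees inside the subgraph induced by `S`. -/
def innerVolume {n : ℕ} (G : EdgeConfig n) (S : Finset (Fin n)) : ℕ :=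
  ∑ i ∈ S, ∑ j ∈ S, adjEntry G i j

lemma adjEntry_comm {n : ℕ} (G : EdgeConfig n) (i j : Fin n) :
    adjEntry G i j = adjEntry G j i := by
  unfold adjEntry
  rw [Sym2.eq_swap]

lemma cutSize_compl {n : ℕ} (G : EdgeConfig n) (S : Finset (Fin n)) :
    cutSize G Sᶜ = cutSize G S := by
  unfold cutSize
  rw [compl_compl, Finset.sum_comm]
  simp_rw [adjEntry_comm G]

lemma volumeOf_eq {n : ℕ} (G : EdgeConfig n) (S : Finset (Fin n)) :
    volumeOf G S = innerVolume G S + cutSize G S := by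
  unfold volumeOf innerVolume cutSize
  rw [← Finset.sum_add_distrib]
  exact Finset.sum_congr rfl fun i _ => (Finset.sum_add_sum_compl S _).symm

lemma volumeOf_univ {n : ℕ} (G : EdgeConfig n) (S : Finset (Fin n)) :
    volumeOf G Finset.univ = volumeOf G S + volumeOf G Sᶜ :=
  (Finset.sum_add_sum_compl S _).symm

/-- The function on pairs with value `a` inside `S`, `b` inside `Sᶜ` and `m` across the cut. -/
def cutTilt {n : ℕ} (S : Finset (Fin n)) (a b m : ℝ) : Sym2 (Fin n) → ℝ :=
  Sym2.lift ⟨fun i j => if i ∈ S then (if j ∈ S then a else m) else (if j ∈ S then m else b),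
    fun i j => by dsimp only; split_ifs <;> rfl⟩

lemma cutTilt_mk {n : ℕ} (S : Finset (Fin n)) (a b m : ℝ) (i j : Fin n) :
    cutTilt S a b m s(i, j)
      = if i ∈ S then (if j ∈ S then a else m) else (if j ∈ S then m else b) := rfl

lemma sum_sum_cutTilt {n : ℕ} (S : Finset (Fin n)) (a b m : ℝ) (g : Fin n → Fin n → ℝ)
    (hg : ∀ i j, g i j = g j i) :
    ∑ i, ∑ j, cutTilt S a b m s(i, j) * g i j
      = a * ∑ i ∈ S, ∑ j ∈ S, g i j + b * ∑ i ∈ Sᶜ, ∑ j ∈ Sᶜ, g i j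
        + 2 * m * ∑ i ∈ S, ∑ j ∈ Sᶜ, g i j := by
  have h1 : ∑ i ∈ S, ∑ j, cutTilt S a b m s(i, j) * g i j
      = a * ∑ i ∈ S, ∑ j ∈ S, g i j + m * ∑ i ∈ S, ∑ j ∈ Sᶜ, g i j := by
    rw [Finset.mul_sum, Finset.mul_sum, ← Finset.sum_add_distrib]
    refine Finset.sum_congr rfl fun i hi => ?_
    rw [← Finset.sum_add_sum_compl S, Finset.mul_sum, Finset.mul_sum]
    congr 1 <;> refine Finset.sum_congr rfl fun j hj => ?_
    · simp [cutTilt_mk, hi, hj]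
    · simp [cutTilt_mk, hi, Finset.mem_compl.1 hj]
  have h2 : ∑ i ∈ Sᶜ, ∑ j, cutTilt S a b m s(i, j) * g i j
      = m * ∑ i ∈ Sᶜ, ∑ j ∈ S, g i j + b * ∑ i ∈ Sᶜ, ∑ j ∈ Sᶜ, g i j := by
    rw [Finset.mul_sum, Finset.mul_sum, ← Finset.sum_add_distrib]
    refine Finset.sum_congr rfl fun i hi => ?_
    rw [← Finset.sum_add_sum_compl S, Finset.mul_sum, Finset.mul_sum]
    congr 1 <;> refine Finset.sum_congr rfl fun j hj => ?_
    · simp [cutTilt_mk, Finset.mem_compl.1 hi, hj]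
    · simp [cutTilt_mk, Finset.mem_compl.1 hi, Finset.mem_compl.1 hj]
  have h3 : ∑ i ∈ Sᶜ, ∑ j ∈ S, g i j = ∑ i ∈ S, ∑ j ∈ Sᶜ, g i j := by
    rw [Finset.sum_comm]
    exact Finset.sum_congr rfl fun i _ => Finset.sum_congr rfl fun j _ => hg _ _
  rw [← Finset.sum_add_sum_compl S, h1, h2, h3]
  ring

lemma sum_sum_edgeProb {n : ℕ} (w : Fin n → ℝ) (S T : Finset (Fin n)) :
    ∑ i ∈ S, ∑ j ∈ T, edgeProb w s(i, j) = (∑ i ∈ S, w i) * (∑ i ∈ T, w i) / ∑ k, w k := by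
  rw [Finset.sum_mul_sum, Finset.sum_div]
  simp_rw [Finset.sum_div, edgeProb_mk]

/-- The Chernoff bound for the degree counts of a cut; the logarithmic parametrization of the
exponents makes the mean values appear linearly. -/
lemma integral_prod_mul_exp_cut_le {n : ℕ} {w : Fin n → ℝ} (hw : ∀ i, 0 < w i)
    (hw2 : ∀ i, w i ^ 2 < ∑ k, w k) (S : Finset (Fin n)) (F : Finset (Sym2 (Fin n)))
    {A B C : ℝ} (hA : 0 < A) (hB : 0 < B) (hC : 0 < C)
    (hF : ∀ e ∈ F, 1 ≤ A ∧ ∃ i ∈ S, ∃ j ∈ S, e = s(i, j)) :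
    ∫ G, (∏ e ∈ F, if G e then 1 else 0) * Real.exp (Real.log A / 2 * innerVolume G S
          + Real.log B / 2 * innerVolume G Sᶜ + Real.log C * cutSize G S)
        ∂(expectedDegreeGraph w)
      ≤ (∏ e ∈ F, edgeProb w e * A)
        * Real.exp ((A - 1) / 2 * ((∑ i ∈ S, w i) ^ 2 / ∑ k, w k)
          + (B - 1) / 2 * ((∑ i ∈ Sᶜ, w i) ^ 2 / ∑ k, w k)
          + (C - 1) * ((∑ i ∈ S, w i) * (∑ i ∈ Sᶜ, w i) / ∑ k, w k)) := by
  have hmul : ∀ x : ℝ, 2 * (x / 2) = x := fun x => by ring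
  set θ := cutTilt S (Real.log A / 2) (Real.log B / 2) (Real.log C / 2) with hθ
  have hin : ∀ e ∈ F, θ e = Real.log A / 2 := by
    intro e he
    obtain ⟨_, i, hi, j, hj, rfl⟩ := hF e he
    rw [hθ, cutTilt_mk, if_pos hi, if_pos hj]
  have key := integral_prod_mul_exp_le hw hw2 θ F (fun e he => by
    rw [hin e he]
    have := Real.log_nonneg (hF e he).1
    linarith)
  have h1 : ∀ G : EdgeConfig n, ∑ i, ∑ j, θ s(i, j) * adjEntry G i j
      = Real.log A / 2 * innerVolume G S
          + Real.log B / 2 * innerVolume G Sᶜ + Real.log C * cutSize G S := by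
    intro G
    rw [hθ, sum_sum_cutTilt S _ _ _ (fun i j => (adjEntry G i j : ℝ))
      (fun i j => by rw [adjEntry_comm]), hmul]
    simp [innerVolume, cutSize]
  have h2 : ∑ i, ∑ j, edgeProb w s(i, j) * (Real.exp (2 * θ s(i, j)) - 1)
      = ∑ i, ∑ j, cutTilt S (A - 1) (B - 1) (C - 1) s(i, j) * edgeProb w s(i, j) := by
    refine Finset.sum_congr rfl fun i _ => Finset.sum_congr rfl fun j _ => ?_
    rw [mul_comm, hθ, cutTilt_mk, cutTilt_mk]
    split_ifs <;> rw [hmul, Real.exp_log ‹_›]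
  simp_rw [h1] at key
  rw [h2, sum_sum_cutTilt _ _ _ _ (fun i j => edgeProb w s(i, j))
    (fun i j => by rw [Sym2.eq_swap])] at key
  simp_rw [sum_sum_edgeProb] at key
  refine key.trans (le_of_eq ?_)
  congr 1
  · refine Finset.prod_congr rfl fun e he => ?_
    rw [hin e he, hmul, Real.exp_log hA]
  · congr 1
    ring

/-- Markov's inequality on the finite space of graphs. -/
lemma measureReal_le_integral {n : ℕ} (w : Fin n → ℝ) (E : Set (EdgeConfig n))
    (φ : EdgeConfig n → ℝ) (h0 : ∀ G, 0 ≤ φ G) (h1 : ∀ G ∈ E, 1 ≤ φ G) :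
    (expectedDegreeGraph w).real E ≤ ∫ G, φ G ∂(expectedDegreeGraph w) := by
  have h2 := mul_meas_ge_le_integral_of_nonneg (μ := expectedDegreeGraph w)
    (ae_of_all _ h0) Integrable.of_finite 1
  rw [one_mul] at h2
  exact (measureReal_mono fun G hG => h1 G hG).trans h2

/-! ### Sets with few boundary edges -/

/-- The bound on the ratio of boundary edges to the inner volume. With this value
`100 ^ (lowCutRatio * a - b) = √1.01 ^ a * 0.01 ^ b`: a slight tilt by the inner volume `a` comes
with a strong one by the number `b` of boundary edges. -/
noncomputable def lowCutRatio : ℝ := Real.log 1.01 / (2 * Real.log 100)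

lemma lowCutRatio_pos : 0 < lowCutRatio :=
  div_pos (Real.log_pos (by norm_num)) (mul_pos two_pos (Real.log_pos (by norm_num)))

/-- `S` is the side of smaller volume of a cut with few edges. -/
def IsLowCut {n : ℕ} (G : EdgeConfig n) (S : Finset (Fin n)) : Prop :=
  (cutSize G S : ℝ) ≤ lowCutRatio * innerVolume G S ∧ innerVolume G S ≤ innerVolume G Sᶜ

lemma isLowCut_of_conductance_lt {n : ℕ} {G : EdgeConfig n} {S : Finset (Fin n)}
    (h : 2 * volumeOf G S ≤ volumeOf G Finset.univ)
    (hc : conductance G S < lowCutRatio / (1 + lowCutRatio)) : IsLowCut G S := by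
  rw [volumeOf_univ G S] at h
  have hle : volumeOf G S ≤ volumeOf G Sᶜ := by omega
  have h1 := volumeOf_eq G S
  have h2 := volumeOf_eq G Sᶜ
  rw [cutSize_compl] at h2
  refine ⟨?_, by omega⟩
  have hη := lowCutRatio_pos
  rw [conductance, min_eq_left hle] at hc
  rcases Nat.eq_zero_or_pos (volumeOf G S) with h0 | h0
  · have : cutSize G S = 0 := by omega
    rw [this, Nat.cast_zero]
    positivity
  · rw [div_lt_div_iff₀ (by exact_mod_cast h0) (by positivity), h1] at hc
    push_cast at hc
    nlinarith

/-- The exponential weight which is at least `1` on low cuts; the factor `u` exploits that the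
inner volume of `S` is the smaller one. -/
lemma one_le_exp_of_isLowCut {n : ℕ} {G : EdgeConfig n} {S : Finset (Fin n)} (h : IsLowCut G S)
    {u : ℝ} (hu : 1 ≤ u) :
    1 ≤ Real.exp (Real.log (1.01 / u) / 2 * innerVolume G S
      + Real.log u / 2 * innerVolume G Sᶜ + Real.log 0.01 * cutSize G S) := by
  apply Real.one_le_exp
  obtain ⟨h1, h2⟩ := h
  have h3 : (innerVolume G S : ℝ) ≤ innerVolume G Sᶜ := by exact_mod_cast h2
  have h4 := Real.log_nonneg hu
  have h5 : (0 : ℝ) < Real.log 100 := Real.log_pos (by norm_num)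
  have h6 : Real.log 0.01 = - Real.log 100 := by
    rw [← Real.log_inv]
    norm_num
  have h7 : Real.log 1.01 / 2 = Real.log 100 * lowCutRatio := by
    unfold lowCutRatio
    field_simp
  rw [Real.log_div (by norm_num) (by linarith), h6, sub_div, h7]
  nlinarith [mul_le_mul_of_nonneg_left h1 h5.le, mul_le_mul_of_nonneg_left h3 h4]

/-- Sets of large expected volume need no connectivity: the probability of a low cut beats the
number `2 ^ n` of all sets. The bound is quadratic and convex in the relative volume, so it is
enough to look at the ends of the ranges, with `u = 1` up to `0.6` and `u = 2` beyond. -/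
lemma measureReal_isLowCut_le {n : ℕ} {w : Fin n → ℝ} (hw : ∀ i, 0 < w i)
    (hw2 : ∀ i, w i ^ 2 < ∑ k, w k) (S : Finset (Fin n)) (hS : ∑ k, w k ≤ 5 * ∑ i ∈ S, w i) :
    (expectedDegreeGraph w).real {G | IsLowCut G S} ≤ Real.exp (-0.15 * ∑ k, w k) := by
  rcases Nat.eq_zero_or_pos n with rfl | hn
  · refine measureReal_le_one.trans ?_
    simp
  have hW : 0 < ∑ k, w k := lt_of_le_of_lt (sq_nonneg _) (hw2 ⟨0, hn⟩)
  have hadd := Finset.sum_add_sum_compl S w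
  have hc : 0 ≤ ∑ i ∈ Sᶜ, w i := Finset.sum_nonneg fun i _ => (hw i).le
  set W := ∑ k, w k
  set x := ∑ i ∈ S, w i
  obtain ⟨y, hy⟩ : ∃ y, x = y * W := ⟨x / W, by field_simp⟩
  have hz : ∑ i ∈ Sᶜ, w i = (1 - y) * W := by linarith
  have hy1 : 1 / 5 ≤ y := by
    rw [hy] at hS
    by_contra! h
    nlinarith
  have hy2 : y ≤ 1 := by
    rw [hz] at hc
    by_contra! h
    nlinarith
  have main : ∀ u : ℝ, 1 ≤ u →
      (1.01 / u - 1) / 2 * y ^ 2 + (u - 1) / 2 * (1 - y) ^ 2 + (0.01 - 1) * (y * (1 - y)) ≤ -0.15 →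
      (expectedDegreeGraph w).real {G | IsLowCut G S} ≤ Real.exp (-0.15 * W) := by
    intro u hu hle
    have h1 := measureReal_le_integral w {G | IsLowCut G S} _
      (fun G => (Real.exp_pos _).le) (fun G hG => one_le_exp_of_isLowCut hG hu)
    refine h1.trans ?_
    have h2 := integral_prod_mul_exp_cut_le hw hw2 S ∅ (A := 1.01 / u) (B := u) (C := 0.01)
      (by positivity) (by positivity) (by positivity) (by simp)
    simp only [Finset.prod_empty, one_mul] at h2
    refine h2.trans (Real.exp_le_exp.2 ?_)
    change (1.01 / u - 1) / 2 * (x ^ 2 / W) + (u - 1) / 2 * ((∑ i ∈ Sᶜ, w i) ^ 2 / W)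
      + (0.01 - 1) * (x * (∑ i ∈ Sᶜ, w i) / W) ≤ _
    rw [hz, hy]
    have e1 : (y * W) ^ 2 / W = y ^ 2 * W := by field_simp
    have e2 : ((1 - y) * W) ^ 2 / W = (1 - y) ^ 2 * W := by field_simp
    have e3 : (y * W) * ((1 - y) * W) / W = y * (1 - y) * W := by field_simp
    rw [e1, e2, e3]
    nlinarith
  rcases le_total y 0.6 with h | h
  · refine main 1 le_rfl ?_
    norm_num
    nlinarith
  · refine main 2 (by norm_num) ?_
    norm_num
    nlinarith

/-! ### Connected sets of small volume -/

/-- In a connected set every node other than the root `r` has a parent, one step closer to `r`;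
the edges to the parents are distinct. -/
lemma exists_parent {n : ℕ} {G : EdgeConfig n} {S : Finset (Fin n)} (hS : IsConnectedSet G S)
    {r : Fin n} (hr : r ∈ S) :
    ∃ f : ↥(S.erase r) → Fin n, (∀ i, f i ∈ S) ∧ (∀ i : ↥(S.erase r), G s((i : Fin n), f i) = true) ∧
      Function.Injective (fun i : ↥(S.erase r) => s((i : Fin n), f i)) := by
  set H := (underlyingGraph G).induce (S : Set (Fin n)) with hH
  have hS' : H.Connected := hS
  have step : ∀ i : ↥(S.erase r), ∃ u : (S : Set (Fin n)),
      G s((i : Fin n), ↑u) = true ∧ ∀ hi : (i : Fin n) ∈ (S : Set (Fin n)),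
        H.dist u ⟨r, hr⟩ < H.dist ⟨i, hi⟩ ⟨r, hr⟩ := by
    rintro ⟨i, hi⟩
    obtain ⟨hne, hiS⟩ := Finset.mem_erase.1 hi
    obtain ⟨p, hp⟩ := hS'.exists_walk_length_eq_dist ⟨i, hiS⟩ ⟨r, hr⟩
    cases p with
    | nil => exact absurd rfl hne
    | @cons _ u _ hadj q =>
      refine ⟨u, ?_, fun _ => ?_⟩
      · have : (underlyingGraph G).Adj i u := hadj
        simpa [underlyingGraph] using this.1
      · rw [← hp, SimpleGraph.Walk.length_cons]
        exact Nat.lt_succ_of_le (SimpleGraph.dist_le q)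
  choose f hf hd using step
  refine ⟨fun i => f i, fun i => (f i).2, hf, fun i j hij => ?_⟩
  rcases Sym2.eq_iff.1 hij with ⟨h, _⟩ | ⟨h1, h2⟩
  · exact Subtype.ext h
  · exfalso
    have hi := hd i (Finset.mem_of_mem_erase i.2)
    have hj := hd j (Finset.mem_of_mem_erase j.2)
    have e1 : (⟨i, Finset.mem_of_mem_erase i.2⟩ : (S : Set (Fin n))) = f j := Subtype.ext h1
    have e2 : f i = (⟨j, Finset.mem_of_mem_erase j.2⟩ : (S : Set (Fin n))) := Subtype.ext h2
    rw [e1, e2] at hi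
    exact lt_asymm hi hj

/-- First moment bound over all parent functions. -/
lemma measureReal_isConnectedSet_and_isLowCut_le {n : ℕ} {w : Fin n → ℝ} (hw : ∀ i, 0 < w i)
    (hw2 : ∀ i, w i ^ 2 < ∑ k, w k) (S : Finset (Fin n)) {r : Fin n} (hr : r ∈ S) :
    (expectedDegreeGraph w).real {G | IsConnectedSet G S ∧ IsLowCut G S}
      ≤ (∏ i ∈ S.erase r, (1.01 * (w i * (∑ j ∈ S, w j) / ∑ k, w k)))
        * Real.exp (0.005 * ((∑ i ∈ S, w i) ^ 2 / ∑ k, w k)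
          - 0.99 * ((∑ i ∈ S, w i) * (∑ i ∈ Sᶜ, w i) / ∑ k, w k)) := by
  classical
  set φ : EdgeConfig n → ℝ := fun G => Real.exp (Real.log 1.01 / 2 * innerVolume G S
    + Real.log 1 / 2 * innerVolume G Sᶜ + Real.log 0.01 * cutSize G S) with hφ
  set E := Real.exp (0.005 * ((∑ i ∈ S, w i) ^ 2 / ∑ k, w k)
          - 0.99 * ((∑ i ∈ S, w i) * (∑ i ∈ Sᶜ, w i) / ∑ k, w k)) with hE
  set T := (Fintype.piFinset fun _ : ↥(S.erase r) => S).filter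
    fun f => Function.Injective (fun i : ↥(S.erase r) => s((i : Fin n), f i)) with hT
  have hpos : ∀ G (f : ↥(S.erase r) → Fin n),
      0 ≤ (∏ e ∈ Finset.univ.image (fun i : ↥(S.erase r) => s((i : Fin n), f i)), if G e then (1 : ℝ) else 0)
        * φ G := by
    intro G f
    refine mul_nonneg (Finset.prod_nonneg fun e _ => ?_) (Real.exp_pos _).le
    split_ifs <;> norm_num
  have h1 := measureReal_le_integral w {G | IsConnectedSet G S ∧ IsLowCut G S}
    (fun G => ∑ f ∈ T, (∏ e ∈ Finset.univ.image (fun i : ↥(S.erase r) => s((i : Fin n), f i)),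
      if G e then (1 : ℝ) else 0) * φ G)
    (fun G => Finset.sum_nonneg fun f _ => hpos G f)
    (by
      rintro G ⟨hG1, hG2⟩
      obtain ⟨f, hfS, hfG, hinj⟩ := exists_parent hG1 hr
      refine le_trans ?_ (Finset.single_le_sum (fun f _ => hpos G f)
        (Finset.mem_filter.2 ⟨Fintype.mem_piFinset.2 hfS, hinj⟩))
      rw [Finset.prod_eq_one, one_mul]
      · have := one_le_exp_of_isLowCut hG2 le_rfl
        rwa [div_one] at this
      · intro e he
        obtain ⟨i, _, rfl⟩ := Finset.mem_image.1 he
        rw [if_pos (hfG i)])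
  refine h1.trans ?_
  rw [integral_finsetSum _ fun f _ => Integrable.of_finite]
  have h2 : ∀ f ∈ T, ∫ G, (∏ e ∈ Finset.univ.image (fun i : ↥(S.erase r) => s((i : Fin n), f i)),
      if G e then (1 : ℝ) else 0) * φ G ∂(expectedDegreeGraph w)
      ≤ (∏ i : ↥(S.erase r), edgeProb w s((i : Fin n), f i) * 1.01) * E := by
    intro f hf
    obtain ⟨hf1, hinj⟩ := Finset.mem_filter.1 hf
    have h3 := integral_prod_mul_exp_cut_le hw hw2 S
      (Finset.univ.image (fun i : ↥(S.erase r) => s((i : Fin n), f i)))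
      (A := 1.01) (B := 1) (C := 0.01) (by norm_num) (by norm_num) (by norm_num) (by
        intro e he
        obtain ⟨i, _, rfl⟩ := Finset.mem_image.1 he
        exact ⟨by norm_num, i, Finset.mem_of_mem_erase i.2, f i, Fintype.mem_piFinset.1 hf1 i, rfl⟩)
    refine h3.trans (le_of_eq ?_)
    rw [Finset.prod_image (fun i _ j _ h => hinj h), hE]
    congr 2
    ring
  refine (Finset.sum_le_sum h2).trans ?_
  rw [← Finset.sum_mul]
  refine mul_le_mul_of_nonneg_right ?_ (Real.exp_pos _).le
  refine (Finset.sum_le_sum_of_subset_of_nonneg (Finset.filter_subset _ _) fun f _ _ =>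
    Finset.prod_nonneg fun i _ => mul_nonneg (edgeProb_nonneg hw _) (by norm_num)).trans ?_
  rw [← Finset.prod_univ_sum (fun _ : ↥(S.erase r) => S)
    (fun i j => edgeProb w s((i : Fin n), j) * 1.01)]
  rw [← Finset.prod_coe_sort (S.erase r)]
  refine le_of_eq (Finset.prod_congr rfl fun i _ => ?_)
  rw [← Finset.sum_mul, mul_comm]
  congr 1
  simp_rw [edgeProb_mk]
  rw [← Finset.sum_div, Finset.mul_sum]

lemma le_mul_exp_div_sub_one {c : ℝ} (hc : 0 < c) (t : ℝ) : t ≤ c * Real.exp (t / c - 1) := by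
  have h := Real.add_one_le_exp (t / c - 1)
  rw [sub_add_cancel, div_le_iff₀ hc] at h
  linarith

/-- A bound in terms of the number of nodes alone. Each node contributes at most
`t ≤ c * exp (t / c - 1)`, and so does the total volume, with `c * m` in place of `c`; the two
exponentials use up the cost `exp (-0.79 * x)` of a low cut, which dictates `c = 2 / 0.79`. -/
lemma measureReal_isConnectedSet_and_isLowCut_le_pow {n : ℕ} {w : Fin n → ℝ}
    (hw : ∀ i, 0 < w i) (hw2 : ∀ i, w i ^ 2 < ∑ k, w k) (S : Finset (Fin n)) {m : ℕ}
    (hm : 0 < m) (hcard : S.card = m + 1) (hS : 5 * ∑ i ∈ S, w i ≤ ∑ k, w k) :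
    (expectedDegreeGraph w).real {G | IsConnectedSet G S ∧ IsLowCut G S}
      ≤ (6.5 * m / (Real.exp 1 ^ 2 * ∑ k, w k)) ^ m := by
  obtain ⟨r, hr⟩ : S.Nonempty := Finset.card_pos.1 (by omega)
  refine (measureReal_isConnectedSet_and_isLowCut_le hw hw2 S hr).trans ?_
  have hW : 0 < ∑ k, w k := lt_of_le_of_lt (sq_nonneg _) (hw2 r)
  have hadd := Finset.sum_add_sum_compl S w
  have hx : 0 < ∑ i ∈ S, w i := Finset.sum_pos (fun i _ => hw i) ⟨r, hr⟩
  have hxr : ∑ i ∈ S.erase r, w i ≤ ∑ i ∈ S, w i :=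
    Finset.sum_le_sum_of_subset_of_nonneg (Finset.erase_subset _ _) fun i _ _ => (hw i).le
  have hcr : (S.erase r).card = m := by rw [Finset.card_erase_of_mem hr, hcard]; rfl
  set W := ∑ k, w k
  set x := ∑ i ∈ S, w i
  set c : ℝ := 2 / 0.79 with hc
  have hc0 : 0 < c := by norm_num [hc]
  have hm0 : (0 : ℝ) < m := by exact_mod_cast hm
  have e1 : ∏ i ∈ S.erase r, (1.01 * (w i * x / W))
      = (1.01 * x / W) ^ m * ∏ i ∈ S.erase r, w i := by
    rw [← hcr, ← Finset.prod_const, ← Finset.prod_mul_distrib]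
    exact Finset.prod_congr rfl fun i _ => by ring
  have e2 : ∏ i ∈ S.erase r, w i ≤ (c * Real.exp (-1)) ^ m * Real.exp (x / c) := by
    calc ∏ i ∈ S.erase r, w i ≤ ∏ i ∈ S.erase r, (c * Real.exp (-1) * Real.exp (w i / c)) := by
          refine Finset.prod_le_prod (fun i _ => (hw i).le) fun i _ => ?_
          refine (le_mul_exp_div_sub_one hc0 (w i)).trans (le_of_eq ?_)
          rw [sub_eq_add_neg, Real.exp_add]
          ring
      _ = (c * Real.exp (-1)) ^ m * Real.exp ((∑ i ∈ S.erase r, w i) / c) := by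
          rw [Finset.prod_mul_distrib, Finset.prod_const, hcr, Finset.sum_div, Real.exp_sum]
      _ ≤ _ := by gcongr
  have e3 : x ^ m ≤ (c * m * Real.exp (-1)) ^ m * Real.exp (x / c) := by
    calc x ^ m ≤ (c * m * Real.exp (x / (c * m) - 1)) ^ m :=
          pow_le_pow_left₀ hx.le (le_mul_exp_div_sub_one (by positivity) x) m
      _ = _ := by
          rw [sub_eq_add_neg, Real.exp_add, ← mul_assoc, mul_right_comm, mul_pow _ (Real.exp _),
            ← Real.exp_nat_mul]
          congr 2
          field_simp
  have e4 : Real.exp (0.005 * (x ^ 2 / W) - 0.99 * (x * (∑ i ∈ Sᶜ, w i) / W))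
      ≤ Real.exp (-(x / c) - x / c) := by
    apply Real.exp_le_exp.2
    have hz : ∑ i ∈ Sᶜ, w i = W - x := by linarith
    have e5 : x * (W - x) / W = x - x ^ 2 / W := by field_simp
    have e6 : x ^ 2 / W ≤ x / 5 := by
      rw [div_le_iff₀ hW]
      nlinarith
    have e7 : x / c = 0.395 * x := by rw [hc]; ring
    rw [hz, e5, e7]
    linarith
  have e8 : (1.01 * c ^ 2 * m * Real.exp (-1) ^ 2 / W) ≤ 6.5 * m / (Real.exp 1 ^ 2 * W) := by
    have : 1.01 * c ^ 2 ≤ 6.5 := by norm_num [hc]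
    rw [Real.exp_neg]
    calc 1.01 * c ^ 2 * m * (Real.exp 1)⁻¹ ^ 2 / W ≤ 6.5 * m * (Real.exp 1)⁻¹ ^ 2 / W := by
          gcongr
      _ = _ := by
          rw [inv_pow]
          field_simp
  calc (∏ i ∈ S.erase r, (1.01 * (w i * x / W)))
        * Real.exp (0.005 * (x ^ 2 / W) - 0.99 * (x * (∑ i ∈ Sᶜ, w i) / W))
      ≤ ((1.01 / W) ^ m * ((c * m * Real.exp (-1)) ^ m * Real.exp (x / c))
          * ((c * Real.exp (-1)) ^ m * Real.exp (x / c))) * Real.exp (-(x / c) - x / c) := by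
        rw [e1, mul_comm 1.01 x, mul_div_assoc, mul_pow, mul_comm (x ^ m)]
        gcongr
        exact Finset.prod_nonneg fun i _ => (hw i).le
    _ = (1.01 * c ^ 2 * m * Real.exp (-1) ^ 2 / W) ^ m
          * (Real.exp (x / c) * Real.exp (x / c) * Real.exp (-(x / c) - x / c)) := by
        have : (1.01 * c ^ 2 * m * Real.exp (-1) ^ 2 / W)
          = (1.01 / W) * ((c * m * Real.exp (-1)) * (c * Real.exp (-1))) := by ring
        rw [this, mul_pow _ (_ * _), mul_pow (c * m * Real.exp (-1))]
        generalize (c * m * Real.exp (-1)) ^ m = a, (c * Real.exp (-1)) ^ m = b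
        ring
    _ = (1.01 * c ^ 2 * m * Real.exp (-1) ^ 2 / W) ^ m := by
        rw [← Real.exp_add, ← Real.exp_add]
        ring_nf
        simp
    _ ≤ _ := pow_le_pow_left₀ (by positivity) e8 m

/-- The union bound over the sets with a given number of nodes. -/
lemma sum_powersetCard_le {n : ℕ} {w : Fin n → ℝ}
    (hw : ∀ i, 0 < w i) (hw2 : ∀ i, w i ^ 2 < ∑ k, w k) (hW : 5.88 * n ≤ ∑ k, w k)
    {m : ℕ} (hm : 0 < m) :
    ∑ S ∈ (Finset.univ.powersetCard (m + 1)).filter fun S => 5 * ∑ i ∈ S, w i ≤ ∑ k, w k,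
      (expectedDegreeGraph w).real {G | IsConnectedSet G S ∧ IsLowCut G S}
      ≤ n * (1 / 2) ^ m := by
  rcases Nat.eq_zero_or_pos n with rfl | hn
  · rw [Finset.powersetCard_eq_empty.2 (by simp)]
    simp
  have hn0 : (0 : ℝ) < n := by exact_mod_cast hn
  have hW0 : 0 < ∑ k, w k := by linarith
  calc _ ≤ ∑ S ∈ (Finset.univ.powersetCard (m + 1)).filter
            fun S : Finset (Fin n) => 5 * ∑ i ∈ S, w i ≤ ∑ k, w k,
          (6.5 * m / (Real.exp 1 ^ 2 * ∑ k, w k)) ^ m := by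
        refine Finset.sum_le_sum fun S hS => ?_
        obtain ⟨h1, h2⟩ := Finset.mem_filter.1 hS
        exact measureReal_isConnectedSet_and_isLowCut_le_pow hw hw2 S hm
          (Finset.mem_powersetCard.1 h1).2 h2
    _ ≤ (n.choose (m + 1) : ℝ) * (6.5 * m / (Real.exp 1 ^ 2 * ∑ k, w k)) ^ m := by
        rw [Finset.sum_const, nsmul_eq_mul]
        gcongr
        refine (Finset.card_filter_le _ _).trans ?_
        simp
    _ ≤ (n * n ^ m / m.factorial) * (6.5 * m / (Real.exp 1 ^ 2 * ∑ k, w k)) ^ m := by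
        gcongr
        refine (Nat.choose_le_pow_div (m + 1) n).trans ?_
        rw [pow_succ']
        gcongr
        exact Nat.le_succ m
    _ = n * (6.5 * n / (Real.exp 1 ^ 2 * ∑ k, w k)) ^ m * (m ^ m / m.factorial) := by
        simp only [div_pow, mul_pow]
        ring
    _ ≤ n * (6.5 * n / (Real.exp 1 ^ 2 * ∑ k, w k)) ^ m * Real.exp 1 ^ m := by
        gcongr
        refine (Real.pow_div_factorial_le_exp (m : ℝ) (by positivity) m).trans (le_of_eq ?_)
        rw [← Real.exp_nat_mul, mul_one]
    _ = n * (6.5 * n / (Real.exp 1 * ∑ k, w k)) ^ m := by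
        rw [mul_assoc, ← mul_pow]
        congr 2
        field_simp
    _ ≤ n * (1 / 2) ^ m := by
        refine mul_le_mul_of_nonneg_left (pow_le_pow_left₀ (by positivity) ?_ m) hn0.le
        rw [div_le_div_iff₀ (by positivity) (by norm_num)]
        nlinarith [Real.exp_one_gt_d9]

/-- The probability that some large connected set of at most half the volume has small
conductance. -/
lemma measureReal_exists_conductance_lt_le {n : ℕ} {w : Fin n → ℝ} (hn : 2 ≤ n)
    (hw : ∀ i, 0 < w i) (hw2 : ∀ i, w i ^ 2 < ∑ k, w k) (hW : 5.88 * n ≤ ∑ k, w k) :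
    (expectedDegreeGraph w).real {G | ∃ S, IsConnectedSet G S ∧ 5 * Real.log n < (S.card : ℝ) ∧
        2 * volumeOf G S ≤ volumeOf G Finset.univ ∧
        conductance G S < lowCutRatio / (1 + lowCutRatio)}
      ≤ 2 * (n : ℝ)⁻¹ + Real.exp (-0.15 * n) := by
  classical
  have hn0 : (0 : ℝ) < n := by positivity
  have hlog2 := Real.log_two_gt_d9
  have hlog : Real.log 2 ≤ Real.log n := Real.log_le_log (by norm_num) (by exact_mod_cast hn)
  set large := Finset.univ.filter fun S : Finset (Fin n) => ∑ k, w k ≤ 5 * ∑ i ∈ S, w i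
  set I := (Finset.range n).filter fun m => 5 * Real.log n < (m + 1 : ℕ)
  set small := fun m => (Finset.univ.powersetCard (m + 1)).filter
    fun S : Finset (Fin n) => 5 * ∑ i ∈ S, w i ≤ ∑ k, w k
  have hsub : {G | ∃ S, IsConnectedSet G S ∧ 5 * Real.log n < (S.card : ℝ) ∧
        2 * volumeOf G S ≤ volumeOf G Finset.univ ∧
        conductance G S < lowCutRatio / (1 + lowCutRatio)}
      ⊆ (⋃ m ∈ I, ⋃ S ∈ small m, {G | IsConnectedSet G S ∧ IsLowCut G S})
        ∪ ⋃ S ∈ large, {G | IsLowCut G S} := by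
    rintro G ⟨S, hS1, hS2, hS3, hS4⟩
    have hlow := isLowCut_of_conductance_lt hS3 hS4
    rcases le_total (∑ k, w k) (5 * ∑ i ∈ S, w i) with h | h
    · right
      exact Set.mem_biUnion (Finset.mem_filter.2 ⟨Finset.mem_univ _, h⟩) hlow
    · left
      have hpos : 0 < S.card := by
        have : (0 : ℝ) < S.card := by linarith
        exact_mod_cast this
      have hle : S.card ≤ n := by simpa using Finset.card_le_univ S
      obtain ⟨m, hm⟩ : ∃ m, S.card = m + 1 := ⟨S.card - 1, by omega⟩
      refine Set.mem_biUnion (x := m)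
        (Finset.mem_filter.2 ⟨Finset.mem_range.2 (by omega), by rwa [← hm]⟩)
        (Set.mem_biUnion (x := S) (Finset.mem_filter.2 ⟨?_, h⟩) ⟨hS1, hlow⟩)
      exact Finset.mem_powersetCard.2 ⟨Finset.subset_univ _, hm⟩
  refine (measureReal_mono hsub).trans ((measureReal_union_le _ _).trans (add_le_add ?_ ?_))
  · calc _ ≤ ∑ m ∈ I, ∑ S ∈ small m,
            (expectedDegreeGraph w).real {G | IsConnectedSet G S ∧ IsLowCut G S} :=
          (measureReal_biUnion_finset_le _ _).trans
            (Finset.sum_le_sum fun m _ => measureReal_biUnion_finset_le _ _)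
      _ ≤ ∑ m ∈ I, 2 * (n : ℝ)⁻¹ ^ 2 := by
          refine Finset.sum_le_sum fun m hm => ?_
          have hm2 := (Finset.mem_filter.1 hm).2
          have hm0 : 0 < m := by
            by_contra! h
            obtain rfl : m = 0 := by omega
            norm_num at hm2
            linarith
          refine (sum_powersetCard_le hw hw2 hW hm0).trans ?_
          have h1 : ((1 : ℝ) / 2) ^ m ≤ 2 * (n : ℝ)⁻¹ ^ 3 := by
            have h2 : ((1 : ℝ) / 2) ^ m = 2 * Real.exp (-(Real.log 2 * (m + 1 : ℕ))) := by
              rw [Real.exp_neg, mul_comm (Real.log 2), Real.exp_nat_mul, Real.exp_log two_pos, pow_succ]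
              rw [one_div, inv_pow]
              field_simp
            have h3 : (n : ℝ)⁻¹ ^ 3 = Real.exp (-(3 * Real.log n)) := by
              rw [Real.exp_neg, show (3 : ℝ) = (3 : ℕ) by norm_num, Real.exp_nat_mul,
                Real.exp_log hn0, inv_pow]
            rw [h2, h3]
            refine mul_le_mul_of_nonneg_left (Real.exp_le_exp.2 (neg_le_neg ?_)) two_pos.le
            have h4 := mul_le_mul_of_nonneg_left hm2.le (Real.log_pos one_lt_two).le
            nlinarith
          calc (n : ℝ) * (1 / 2) ^ m ≤ n * (2 * (n : ℝ)⁻¹ ^ 3) := by gcongr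
            _ = 2 * (n : ℝ)⁻¹ ^ 2 := by field_simp
      _ ≤ n * (2 * (n : ℝ)⁻¹ ^ 2) := by
          rw [Finset.sum_const, nsmul_eq_mul]
          gcongr
          exact (Finset.card_filter_le _ _).trans (by simp)
      _ = 2 * (n : ℝ)⁻¹ := by field_simp
  · calc _ ≤ ∑ S ∈ large, (expectedDegreeGraph w).real {G | IsLowCut G S} :=
          measureReal_biUnion_finset_le _ _
      _ ≤ ∑ S ∈ large, Real.exp (-0.15 * ∑ k, w k) :=
          Finset.sum_le_sum fun S hS =>
            measureReal_isLowCut_le hw hw2 S (Finset.mem_filter.1 hS).2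
      _ ≤ 2 ^ n * Real.exp (-0.15 * (5.88 * n)) := by
          rw [Finset.sum_const, nsmul_eq_mul]
          refine mul_le_mul ?_ (Real.exp_le_exp.2 (by linarith)) (Real.exp_pos _).le (by positivity)
          have : large.card ≤ 2 ^ n := (Finset.card_filter_le _ _).trans (by simp)
          exact_mod_cast this
      _ ≤ Real.exp (-0.15 * n) := by
          have h2 : (2 : ℝ) ^ n = Real.exp (n * Real.log 2) := by
            rw [Real.exp_nat_mul, Real.exp_log two_pos]
          rw [h2, ← Real.exp_add]
          apply Real.exp_le_exp.2
          nlinarith [Real.log_two_lt_d9]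

/-! ### The power-law weights -/

lemma rpow_add_one_sub_le {a x : ℝ} (ha : 0 ≤ a) (ha1 : a ≤ 1) (hx : 0 < x) :
    (x + 1) ^ a - x ^ a ≤ a * x ^ (a - 1) := by
  have h := rpow_one_add_le_one_add_mul_self (s := 1 / x) (by
    have : 0 < 1 / x := by positivity
    linarith) ha ha1
  have h1 : x + 1 = x * (1 + 1 / x) := by field_simp
  rw [h1, Real.mul_rpow hx.le (by positivity), Real.rpow_sub_one hx.ne']
  have h2 := mul_le_mul_of_nonneg_left h (Real.rpow_nonneg hx.le a)
  calc _ ≤ x ^ a * (1 + a * (1 / x)) - x ^ a := by linarith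
    _ = _ := by ring

lemma le_rpow_sub_rpow_sub_one {a x : ℝ} (ha : 0 ≤ a) (ha1 : a ≤ 1) (hx : 1 ≤ x) :
    a * x ^ (a - 1) ≤ x ^ a - (x - 1) ^ a := by
  have hx0 : 0 < x := by linarith
  have h4 : 1 / x ≤ 1 := (div_le_one hx0).2 hx
  have h := rpow_one_add_le_one_add_mul_self (s := -(1 / x)) (by linarith) ha ha1
  have h1 : x - 1 = x * (1 + -(1 / x)) := by field_simp; ring
  rw [h1, Real.mul_rpow hx0.le (by linarith), Real.rpow_sub_one hx0.ne']
  have h2 := mul_le_mul_of_nonneg_left h (Real.rpow_nonneg hx0.le a)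
  calc _ = x ^ a - x ^ a * (1 + a * -(1 / x)) := by ring
    _ ≤ _ := by linarith

/-- The properties of the weights on which the argument rests: their order of magnitude, and
the value `5.88` of the average weight. -/
lemma eventually_powerLawWeight_bounds (β w : ℝ) (hβ : 2 < β) (hw : 5.88 < w) :
    ∃ l K C : ℝ, 0 < l ∧ 0 < K ∧ 0 < C ∧
      ∀ wmax : ℕ → ℝ, Tendsto wmax atTop atTop →
        (∀ᶠ n in atTop, ∀ i : Fin n,
          powerLawWeight β w (wmax n) n i ^ 2 < ∑ k, powerLawWeight β w (wmax n) n k) →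
        ∀ᶠ n in atTop, (∀ j : Fin n, l ≤ powerLawWeight β w (wmax n) n j) ∧
          (∀ j : Fin n, n ≤ 2 * (j : ℕ) → powerLawWeight β w (wmax n) n j ≤ K) ∧
          5.88 * n ≤ ∑ k, powerLawWeight β w (wmax n) n k ∧
          ∑ k, powerLawWeight β w (wmax n) n k ≤ C * n := by
  set γ := 1 / (β - 1) with hγ
  set α := powerLawAlpha β with hα
  have hβ1 : 0 < β - 1 := by linarith
  have hα0 : 0 < α := div_pos (by linarith) hβ1
  have hγα : α - 1 = -γ := by
    rw [hα, hγ, powerLawAlpha]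
    field_simp
    ring
  have hγ0 : 0 < γ := by positivity
  have hα1 : α ≤ 1 := by linarith
  have hw0 : 0 < w := by linarith
  have hneg : -1 / (β - 1) = -γ := by rw [hγ]; ring
  refine ⟨α * w * 2 ^ (-γ), α * w * 2 ^ γ, 2 * w, by positivity, by positivity, by positivity,
    fun wmax hmax hsq => ?_⟩
  set δ : ℕ → ℝ := fun n => (α * (w / wmax n)) ^ (β - 1) with hδ
  have hδ0 : Tendsto δ atTop (𝓝 0) := by
    have h1 : Tendsto (fun n => α * (w / wmax n)) atTop (𝓝 0) := by
      simpa using (hmax.const_div_atTop w).const_mul α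
    have h2 := h1.rpow_const (p := β - 1) (Or.inr hβ1.le)
    rwa [Real.zero_rpow hβ1.ne'] at h2
  have hδα : Tendsto (fun n => w * (1 - δ n ^ α)) atTop (𝓝 w) := by
    have h2 := hδ0.rpow_const (p := α) (Or.inr hα0.le)
    rw [Real.zero_rpow hα0.ne'] at h2
    simpa using (h2.const_sub 1).const_mul w
  filter_upwards [hsq, hmax.eventually_gt_atTop 0, hδ0.eventually_le_const one_pos,
    hδα.eventually_const_le hw, eventually_ge_atTop 1] with n hsq hmax hδ1 havg hn
  have hn0 : (0 : ℝ) < n := by exact_mod_cast hn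
  have hδp : 0 < δ n := by
    have : 0 < α * (w / wmax n) := by positivity
    exact Real.rpow_pos_of_pos this _
  have hwt : ∀ j : Fin n, powerLawWeight β w (wmax n) n j
      = α * w * (n : ℝ) ^ γ * (n * δ n + (j : ℕ)) ^ (-γ) := by
    intro j
    rw [powerLawWeight, powerLawCoeff, powerLawShift, hneg]
  have hscale : ∀ {c : ℝ}, 0 < c → (n : ℝ) ^ γ * (c * n) ^ (-γ) = c ^ (-γ) := by
    intro c hc
    rw [Real.mul_rpow hc.le hn0.le, mul_left_comm, ← Real.rpow_add hn0]
    simp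
  have hscale' : (n : ℝ) ^ γ * (n : ℝ) ^ α = n := by
    rw [← Real.rpow_add hn0, show γ + α = 1 by linarith, Real.rpow_one]
  have hi0 : 0 < n * δ n := by positivity
  refine ⟨fun j => ?_, fun j hj => ?_, ?_, ?_⟩
  · rw [hwt, mul_assoc (α * w)]
    refine mul_le_mul_of_nonneg_left ?_ (by positivity)
    rw [← hscale two_pos]
    refine mul_le_mul_of_nonneg_left ?_ (by positivity)
    refine Real.rpow_le_rpow_of_nonpos (by positivity) ?_ (by linarith)
    have : ((j : ℕ) : ℝ) ≤ n := by exact_mod_cast j.2.le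
    nlinarith
  · rw [hwt, mul_assoc (α * w)]
    refine mul_le_mul_of_nonneg_left ?_ (by positivity)
    have h2 : (2 : ℝ) ^ γ = (1 / 2 : ℝ) ^ (-γ) := by
      rw [Real.rpow_neg (by norm_num), ← Real.inv_rpow (by norm_num)]
      norm_num
    rw [h2, ← hscale (by norm_num : (0 : ℝ) < 1 / 2)]
    refine mul_le_mul_of_nonneg_left ?_ (by positivity)
    refine Real.rpow_le_rpow_of_nonpos (by positivity) ?_ (by linarith)
    have : (n : ℝ) ≤ 2 * (j : ℕ) := by exact_mod_cast hj
    linarith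
  · simp_rw [hwt]
    have h1 : (n * δ n + n) ^ α - (n * δ n) ^ α
        ≤ ∑ k : Fin n, α * (n * δ n + (k : ℕ)) ^ (-γ) := by
      rw [← Finset.sum_range (fun k => α * (n * δ n + (k : ℕ)) ^ (-γ))]
      have h2 := Finset.sum_range_sub (fun k : ℕ => (n * δ n + k) ^ α) n
      simp only [Nat.cast_zero, add_zero] at h2
      rw [← h2]
      refine Finset.sum_le_sum fun k _ => ?_
      have := rpow_add_one_sub_le hα0.le hα1 (x := n * δ n + k) (by positivity)
      rw [hγα] at this
      push_cast
      rwa [← add_assoc]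
    have h3 : (n : ℝ) ^ α * (1 - δ n ^ α) ≤ (n * δ n + n) ^ α - (n * δ n) ^ α := by
      rw [mul_sub, mul_one, ← Real.mul_rpow hn0.le hδp.le]
      have : (n : ℝ) ^ α ≤ (n * δ n + n) ^ α :=
        Real.rpow_le_rpow hn0.le (by linarith) hα0.le
      linarith
    calc 5.88 * (n : ℝ) ≤ w * (1 - δ n ^ α) * n := by gcongr
      _ = w * (n : ℝ) ^ γ * ((n : ℝ) ^ α * (1 - δ n ^ α)) := by
        nth_rewrite 1 [← hscale']
        ring
      _ ≤ w * (n : ℝ) ^ γ * ∑ k : Fin n, α * (n * δ n + (k : ℕ)) ^ (-γ) := by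
        gcongr
        linarith
      _ = _ := by
        rw [Finset.mul_sum]
        exact Finset.sum_congr rfl fun k _ => by ring
  · obtain ⟨N, rfl⟩ : ∃ N, n = N + 1 := ⟨n - 1, by omega⟩
    have htail : ∑ k : Fin N, powerLawWeight β w (wmax (N + 1)) (N + 1) k.succ
        ≤ w * (N + 1 : ℕ) := by
      have h1 : ∑ k : Fin N, α * ((k : ℕ) + 1 : ℝ) ^ (-γ) ≤ ((N + 1 : ℕ) : ℝ) ^ α := by
        rw [← Finset.sum_range (fun k => α * ((k : ℕ) + 1 : ℝ) ^ (-γ))]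
        calc _ ≤ ∑ k ∈ Finset.range N, (((k + 1 : ℕ) : ℝ) ^ α - (k : ℝ) ^ α) := by
              refine Finset.sum_le_sum fun k _ => ?_
              have := le_rpow_sub_rpow_sub_one hα0.le hα1 (x := k + 1) (by simp)
              rw [hγα] at this
              push_cast
              simpa using this
          _ = (N : ℝ) ^ α := by
              rw [Finset.sum_range_sub (fun k : ℕ => (k : ℝ) ^ α)]
              simp [Real.zero_rpow hα0.ne']
          _ ≤ _ := Real.rpow_le_rpow (by positivity) (by simp) hα0.le
      calc _ ≤ ∑ k : Fin N, w * ((N + 1 : ℕ) : ℝ) ^ γ * (α * ((k : ℕ) + 1 : ℝ) ^ (-γ)) := by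
            refine Finset.sum_le_sum fun k _ => ?_
            rw [hwt]
            have h2 : (((N + 1 : ℕ) : ℝ) * δ (N + 1) + (k.succ : ℕ)) ^ (-γ)
                ≤ ((k : ℕ) + 1 : ℝ) ^ (-γ) := by
              refine Real.rpow_le_rpow_of_nonpos (by positivity) ?_ (by linarith)
              rw [Fin.val_succ]
              push_cast at hi0 ⊢
              linarith
            calc _ ≤ α * w * ((N + 1 : ℕ) : ℝ) ^ γ * ((k : ℕ) + 1 : ℝ) ^ (-γ) := by gcongr
              _ = _ := by ring
        _ ≤ w * ((N + 1 : ℕ) : ℝ) ^ γ * ((N + 1 : ℕ) : ℝ) ^ α := by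
            rw [← Finset.mul_sum]
            gcongr
        _ = _ := by rw [mul_assoc, hscale']
    -- The largest weight `t` satisfies `t ^ 2 < t + w * n`, hence `t ≤ w * n`.
    have h0 := hsq 0
    rw [Fin.sum_univ_succ] at h0 ⊢
    have hn1 : (1 : ℝ) ≤ (N + 1 : ℕ) := by exact_mod_cast hn
    have hwn : 5.88 ≤ w * (N + 1 : ℕ) := by nlinarith
    have hle : powerLawWeight β w (wmax (N + 1)) (N + 1) 0 ≤ w * (N + 1 : ℕ) := by
      by_contra! h
      nlinarith
    linarith

/-! ### Prescribing the edges in a set of pairs -/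

/-- The graphs whose edges among the pairs in `T` are exactly those in `F`. -/
def patternEvent {n : ℕ} (T F : Finset (Sym2 (Fin n))) : Set (EdgeConfig n) :=
  {G | ∀ e ∈ T, G e = true ↔ e ∈ F}

lemma measureReal_patternEvent {n : ℕ} {w : Fin n → ℝ} (hw : ∀ i, 0 < w i)
    (hw2 : ∀ i, w i ^ 2 < ∑ k, w k) (T F : Finset (Sym2 (Fin n))) :
    (expectedDegreeGraph w).real (patternEvent T F)
      = ∏ e ∈ T, if e ∈ F then edgeProb w e else 1 - edgeProb w e := by
  classical
  obtain ⟨f, hf⟩ : ∃ f : Sym2 (Fin n) → Bool → ℝ, ∀ e b, f e b =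
      if e ∈ T then (if (b = true ↔ e ∈ F) then 1 else 0) else 1 := ⟨_, fun _ _ => rfl⟩
  have h1 : ∀ G, (patternEvent T F).indicator 1 G = ∏ e, f e (G e) := by
    intro G
    simp_rw [hf]
    rw [Finset.prod_ite_mem, Finset.univ_inter, Finset.prod_ite_zero]
    simp [Set.indicator_apply, patternEvent]
  rw [← integral_indicator_one (Set.toFinite _).measurableSet,
    integral_congr_ae (ae_of_all _ h1), integral_prod_edges hw hw2 f]
  simp_rw [hf]
  rw [← Finset.univ_inter T, ← Finset.prod_ite_mem]
  refine Finset.prod_congr rfl fun e _ => ?_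
  by_cases h : e ∈ T <;> by_cases h' : e ∈ F <;> simp [h, h']

lemma exp_neg_two_mul_le {p : ℝ} (h0 : 0 ≤ p) (h1 : p ≤ 1 / 2) : Real.exp (-(2 * p)) ≤ 1 - p := by
  rw [Real.exp_neg]
  refine inv_le_of_inv_le₀ (by linarith) ?_
  refine le_trans ?_ (Real.add_one_le_exp _)
  rw [inv_le_iff_one_le_mul₀ (by linarith)]
  nlinarith

lemma exp_neg_two_mul_sum_le_prod {ι : Type*} (T : Finset ι) {p : ι → ℝ} {s : ℝ}
    (h0 : ∀ e ∈ T, 0 ≤ p e) (h1 : ∀ e ∈ T, p e ≤ 1 / 2) (hs : ∑ e ∈ T, p e ≤ s) :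
    Real.exp (-(2 * s)) ≤ ∏ e ∈ T, (1 - p e) := by
  calc Real.exp (-(2 * s)) ≤ Real.exp (∑ e ∈ T, -(2 * p e)) := by
        rw [Finset.sum_neg_distrib, ← Finset.mul_sum]
        gcongr
    _ = ∏ e ∈ T, Real.exp (-(2 * p e)) := Real.exp_sum _ _
    _ ≤ _ := Finset.prod_le_prod (fun e _ => (Real.exp_pos _).le)
        fun e he => exp_neg_two_mul_le (h0 e he) (h1 e he)

/-- Two patterns that prescribe the absence of all pairs they both speak about are nearly
independent. -/
lemma measureReal_patternEvent_inter_le {n : ℕ} {w : Fin n → ℝ} (hw : ∀ i, 0 < w i)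
    (hw2 : ∀ i, w i ^ 2 < ∑ k, w k) {T F T' F' : Finset (Sym2 (Fin n))}
    (hT : Disjoint T F') (hT' : Disjoint T' F) {s : ℝ}
    (hp : ∀ e ∈ T ∩ T', edgeProb w e ≤ 1 / 2) (hs : ∑ e ∈ T ∩ T', edgeProb w e ≤ s) :
    (expectedDegreeGraph w).real (patternEvent T F ∩ patternEvent T' F')
      ≤ Real.exp (2 * s) * ((expectedDegreeGraph w).real (patternEvent T F)
        * (expectedDegreeGraph w).real (patternEvent T' F')) := by
  classical
  have hsub : patternEvent T F ∩ patternEvent T' F' ⊆ patternEvent (T ∪ T') (F ∪ F') := by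
    rintro G ⟨h1, h2⟩ e he
    rw [Finset.mem_union]
    rcases Finset.mem_union.1 he with h | h
    · rw [h1 e h]
      exact ⟨Or.inl, fun h3 => h3.resolve_right (Finset.disjoint_left.1 hT h)⟩
    · rw [h2 e h]
      exact ⟨Or.inr, fun h3 => h3.resolve_left (Finset.disjoint_left.1 hT' h)⟩
  set g : Sym2 (Fin n) → ℝ := fun e =>
    if e ∈ F ∪ F' then edgeProb w e else 1 - edgeProb w e with hg
  have e1 : (expectedDegreeGraph w).real (patternEvent T F) = ∏ e ∈ T, g e := by
    rw [measureReal_patternEvent hw hw2]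
    refine Finset.prod_congr rfl fun e he => ?_
    simp [hg, Finset.disjoint_left.1 hT he]
  have e2 : (expectedDegreeGraph w).real (patternEvent T' F') = ∏ e ∈ T', g e := by
    rw [measureReal_patternEvent hw hw2]
    refine Finset.prod_congr rfl fun e he => ?_
    simp [hg, Finset.disjoint_left.1 hT' he]
  have e3 : ∏ e ∈ T ∩ T', g e = ∏ e ∈ T ∩ T', (1 - edgeProb w e) := by
    refine Finset.prod_congr rfl fun e he => ?_
    obtain ⟨h, h'⟩ := Finset.mem_inter.1 he
    simp [hg, Finset.disjoint_left.1 hT h, Finset.disjoint_left.1 hT' h']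
  have e4 := exp_neg_two_mul_sum_le_prod (T ∩ T') (fun e _ => edgeProb_nonneg hw e) hp hs
  refine (measureReal_mono hsub).trans ?_
  rw [e1, e2, ← Finset.prod_union_inter, e3, measureReal_patternEvent hw hw2]
  have h5 : 0 ≤ ∏ e ∈ T ∪ T', g e := Finset.prod_nonneg fun e _ => by
    have h6 := edgeProb_nonneg hw e
    have h7 := edgeProb_le_one hw2 e
    simp only [hg]
    split_ifs <;> linarith
  have h8 : 1 ≤ Real.exp (2 * s) * ∏ e ∈ T ∩ T', (1 - edgeProb w e) := by
    calc (1 : ℝ) = Real.exp (2 * s) * Real.exp (-(2 * s)) := by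
          rw [← Real.exp_add]
          simp
      _ ≤ _ := by gcongr
  calc _ = (∏ e ∈ T ∪ T', g e) * 1 := (mul_one _).symm
    _ ≤ (∏ e ∈ T ∪ T', g e) * (Real.exp (2 * s) * ∏ e ∈ T ∩ T', (1 - edgeProb w e)) :=
        mul_le_mul_of_nonneg_left h8 h5
    _ = _ := by ring

/-- Second moment method: nearly uncorrelated events with a large expected number of occurrences
do not all fail, and at least two of them occur. -/
lemma measureReal_forall_eq_le {Ω ι : Type*} [Finite Ω] [MeasurableSpace Ω]
    [MeasurableSingletonClass Ω] [Fintype ι] (μ : Measure Ω) [IsProbabilityMeasure μ]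
    (A : ι → Set Ω) {Λ ζ : ℝ} (hζ : 0 ≤ ζ) (hΛ : Λ ≤ ∑ u, μ.real (A u)) (hΛ2 : 2 ≤ Λ)
    (hA : ∀ u v, u ≠ v → μ.real (A u ∩ A v) ≤ (1 + ζ) * (μ.real (A u) * μ.real (A v))) :
    μ.real {G | ∀ u v, G ∈ A u → G ∈ A v → u = v} ≤ 4 / Λ + 4 * ζ := by
  classical
  set L := ∑ u, μ.real (A u) with hL
  set X : Ω → ℝ := fun G => ∑ u, (A u).indicator 1 G with hX
  have hmeas : ∀ s : Set Ω, MeasurableSet s := fun s => (Set.toFinite s).measurableSet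
  have hEX : ∫ G, X G ∂μ = L := by
    rw [hX, integral_finsetSum _ fun f _ => Integrable.of_finite]
    exact Finset.sum_congr rfl fun u _ => integral_indicator_one (hmeas _)
  have hEX2 : ∫ G, X G ^ 2 ∂μ ≤ L + (1 + ζ) * L ^ 2 := by
    have h1 : ∀ G, X G ^ 2 = ∑ u, ∑ v, (A u ∩ A v).indicator (1 : Ω → ℝ) G := by
      intro G
      rw [hX, sq, Finset.sum_mul_sum]
      simp_rw [Set.inter_indicator_one, Pi.mul_apply]
    simp_rw [h1]
    rw [integral_finsetSum _ fun f _ => Integrable.of_finite]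
    simp_rw [integral_finsetSum _ fun f _ => Integrable.of_finite,
      integral_indicator_one (hmeas _)]
    calc ∑ u, ∑ v, μ.real (A u ∩ A v)
        ≤ ∑ u, ∑ v, ((if u = v then μ.real (A u) else 0)
          + (1 + ζ) * (μ.real (A u) * μ.real (A v))) := by
          refine Finset.sum_le_sum fun u _ => Finset.sum_le_sum fun v _ => ?_
          have hpos : 0 ≤ (1 + ζ) * (μ.real (A u) * μ.real (A v)) := by positivity
          by_cases huv : u = v
          · subst huv
            simp only [Set.inter_self, if_true]
            linarith
          · simpa [huv] using hA u v huv
      _ = L + (1 + ζ) * L ^ 2 := by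
          simp_rw [Finset.sum_add_distrib, Finset.sum_ite_eq, Finset.mem_univ, if_true,
            ← Finset.mul_sum, ← Finset.sum_mul]
          rw [← hL]
          ring
  have hvar : ∫ G, (X G - L) ^ 2 ∂μ ≤ L + ζ * L ^ 2 := by
    have h1 : ∀ G, (X G - L) ^ 2 = X G ^ 2 - 2 * L * X G + L ^ 2 := fun G => by ring
    simp_rw [h1]
    rw [integral_add Integrable.of_finite Integrable.of_finite,
      integral_sub Integrable.of_finite Integrable.of_finite, integral_const_mul, hEX,
      integral_const]
    simp
    nlinarith
  have hmarkov := mul_meas_ge_le_integral_of_nonneg (μ := μ)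
    (ae_of_all _ fun G => sq_nonneg (X G - L)) Integrable.of_finite ((L / 2) ^ 2)
  have hsub : {G | ∀ u v, G ∈ A u → G ∈ A v → u = v} ⊆ {G | (L / 2) ^ 2 ≤ (X G - L) ^ 2} := by
    intro G hG
    have hX1 : X G ≤ 1 := by
      have hc : X G = ((Finset.univ.filter fun u => G ∈ A u).card : ℝ) := by
        rw [hX]
        simp [Set.indicator_apply]
      rw [hc]
      have : (Finset.univ.filter fun u => G ∈ A u).card ≤ 1 :=
        Finset.card_le_one.2 fun u hu v hv =>
          hG u v (Finset.mem_filter.1 hu).2 (Finset.mem_filter.1 hv).2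
      exact_mod_cast this
    change (L / 2) ^ 2 ≤ (X G - L) ^ 2
    nlinarith
  have hL0 : 0 < L := by linarith
  have h5 := measureReal_mono (μ := μ) hsub
  have h6 : μ.real {G | ∀ u v, G ∈ A u → G ∈ A v → u = v} * (L / 2) ^ 2 ≤ L + ζ * L ^ 2 := by
    refine le_trans ?_ (hmarkov.trans hvar)
    rw [mul_comm]
    gcongr
  rw [← le_div_iff₀ (by positivity)] at h6
  refine h6.trans ?_
  calc (L + ζ * L ^ 2) / (L / 2) ^ 2 = 4 / L + 4 * ζ := by field_simp; ring
    _ ≤ _ := by gcongr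

/-! ### Paths that hang on a single edge -/

/-- The edges `{u 0, u 1}, {u 1, u 2}, …` along a sequence of nodes. -/
def pathEdges {n m : ℕ} (u : Fin (m + 2) → Fin n) : Finset (Sym2 (Fin n)) :=
  Finset.univ.image fun i : Fin (m + 1) => s(u i.castSucc, u i.succ)

/-- The nodes of a sequence except for the first one, the anchor. -/
def pathBody {n m : ℕ} (u : Fin (m + 2) → Fin n) : Finset (Fin n) :=
  Finset.univ.image fun i : Fin (m + 1) => u i.succ

/-- The pairs with at least one node in `S`. -/
def touchingPairs {n : ℕ} (S : Finset (Fin n)) : Finset (Sym2 (Fin n)) :=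
  Finset.univ.filter fun e => ∃ i ∈ S, i ∈ e

/-- The body of `u` is an induced path without loops, joined to its complement by the edge
between `u 1` and the anchor `u 0` alone. -/
def whiskerEvent {n m : ℕ} (u : Fin (m + 2) → Fin n) : Set (EdgeConfig n) :=
  patternEvent (touchingPairs (pathBody u)) (pathEdges u)

/-- Sequences of distinct nodes of which the anchor has a label below `n / 2`, and all others
have a label of at least `n / 2`, hence a bounded weight. The anchors are kept apart from the
bodies so that two different whiskers of this kind cannot overlap. -/
abbrev HangingPath (n m : ℕ) : Type :=
  {u : Fin (m + 2) → Fin n // Function.Injective u ∧ 2 * (u 0 : ℕ) < n ∧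
    ∀ i : Fin (m + 1), n ≤ 2 * (u i.succ : ℕ)}

lemma mem_pathBody {n m : ℕ} {u : Fin (m + 2) → Fin n} {a : Fin (m + 2)} (ha : a ≠ 0) :
    u a ∈ pathBody u := by
  obtain ⟨i, rfl⟩ := Fin.exists_succ_eq.2 ha
  exact Finset.mem_image_of_mem _ (Finset.mem_univ i)

lemma mem_pathBody_iff {n m : ℕ} {u : Fin (m + 2) → Fin n} {x : Fin n} :
    x ∈ pathBody u ↔ ∃ a, a ≠ 0 ∧ u a = x := by
  constructor
  · intro h
    obtain ⟨i, _, rfl⟩ := Finset.mem_image.1 h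
    exact ⟨i.succ, Fin.succ_ne_zero i, rfl⟩
  · rintro ⟨a, ha, rfl⟩
    exact mem_pathBody ha

lemma card_pathBody {n m : ℕ} {u : Fin (m + 2) → Fin n} (hu : Function.Injective u) :
    (pathBody u).card = m + 1 := by
  unfold pathBody
  rw [Finset.card_image_of_injective _
    (show Function.Injective fun i : Fin (m + 1) => u i.succ from hu.comp (Fin.succ_injective _))]
  simp

lemma mem_pathEdges_iff {n m : ℕ} {u : Fin (m + 2) → Fin n} {e : Sym2 (Fin n)} :
    e ∈ pathEdges u ↔ ∃ a b : Fin (m + 2), (b : ℕ) = a + 1 ∧ e = s(u a, u b) := by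
  constructor
  · intro h
    obtain ⟨i, _, rfl⟩ := Finset.mem_image.1 h
    exact ⟨i.castSucc, i.succ, by simp, rfl⟩
  · rintro ⟨a, b, hab, rfl⟩
    refine Finset.mem_image.2 ⟨⟨a, by omega⟩, Finset.mem_univ _, ?_⟩
    congr
    exact Fin.ext (by simp [hab])

lemma card_pathEdges {n m : ℕ} {u : Fin (m + 2) → Fin n} (hu : Function.Injective u) :
    (pathEdges u).card = m + 1 := by
  unfold pathEdges
  rw [Finset.card_image_of_injective]
  · simp
  · intro i j hij
    rcases Sym2.eq_iff.1 hij with ⟨h, _⟩ | ⟨h1, h2⟩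
    · exact Fin.castSucc_injective _ (hu h)
    · have h3 := congrArg Fin.val (hu h1)
      have h4 := congrArg Fin.val (hu h2)
      simp at h3 h4
      omega

lemma edge_iff_of_mem_whiskerEvent {n m : ℕ} {u : Fin (m + 2) → Fin n}
    (hu : Function.Injective u) {G : EdgeConfig n} (hG : G ∈ whiskerEvent u)
    {a : Fin (m + 2)} (ha : a ≠ 0) (y : Fin n) :
    G s(u a, y) = true ↔ ∃ b : Fin (m + 2), y = u b ∧ ((b : ℕ) = a + 1 ∨ (a : ℕ) = b + 1) := by
  have h := hG s(u a, y)
    (Finset.mem_filter.2 ⟨Finset.mem_univ _, u a, mem_pathBody ha, Sym2.mem_mk_left _ _⟩)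
  rw [h, mem_pathEdges_iff]
  constructor
  · rintro ⟨c, d, hcd, h1⟩
    rcases Sym2.eq_iff.1 h1 with ⟨h2, h3⟩ | ⟨h2, h3⟩
    · exact ⟨d, h3, Or.inl (by rw [hu h2]; exact hcd)⟩
    · exact ⟨c, h3, Or.inr (by rw [hu h2]; exact hcd)⟩
  · rintro ⟨b, rfl, h1 | h1⟩
    · exact ⟨a, b, h1, rfl⟩
    · exact ⟨b, a, h1, Sym2.eq_swap⟩

lemma cutSize_pathBody {n m : ℕ} {u : Fin (m + 2) → Fin n}
    (hu : Function.Injective u) {G : EdgeConfig n} (hG : G ∈ whiskerEvent u) :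
    cutSize G (pathBody u) = 1 := by
  have h10 : (1 : Fin (m + 2)) ≠ 0 := by simp
  have h0 : u 0 ∉ pathBody u := by
    rw [mem_pathBody_iff]
    rintro ⟨a, ha, h⟩
    exact ha (hu h)
  have hout : ∀ a : Fin (m + 2), a ≠ 0 → ∀ y ∉ pathBody u, G s(u a, y) = true →
      a = 1 ∧ y = u 0 := by
    intro a ha y hy hay
    obtain ⟨b, rfl, hb⟩ := (edge_iff_of_mem_whiskerEvent hu hG ha y).1 hay
    have hb0 : b = 0 := by
      by_contra h
      exact hy (mem_pathBody h)
    subst hb0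
    refine ⟨Fin.ext ?_, rfl⟩
    simpa using hb
  unfold cutSize
  rw [Finset.sum_eq_single (u 1), Finset.sum_eq_single (u 0)]
  · have : G s(u 1, u 0) = true :=
      (edge_iff_of_mem_whiskerEvent hu hG h10 _).2 ⟨0, rfl, Or.inr (by simp)⟩
    simp [adjEntry, this]
  · intro y hy hne
    rw [adjEntry, if_neg]
    exact fun h => hne (hout 1 h10 y (Finset.mem_compl.1 hy) h).2
  · exact fun h => absurd (Finset.mem_compl.2 h0) h
  · intro x hx hne
    obtain ⟨a, ha, rfl⟩ := mem_pathBody_iff.1 hx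
    refine Finset.sum_eq_zero fun y hy => ?_
    rw [adjEntry, if_neg]
    intro h
    exact hne (by rw [(hout a ha y (Finset.mem_compl.1 hy) h).1])
  · exact fun h => absurd (mem_pathBody h10) h

lemma degree_pathBody_bounds {n m : ℕ} {u : Fin (m + 2) → Fin n}
    (hu : Function.Injective u) {G : EdgeConfig n} (hG : G ∈ whiskerEvent u)
    {x : Fin n} (hx : x ∈ pathBody u) :
    1 ≤ ∑ j, adjEntry G x j ∧ ∑ j, adjEntry G x j ≤ 2 := by
  obtain ⟨a, ha, rfl⟩ := mem_pathBody_iff.1 hx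
  have ha' : (a : ℕ) ≠ 0 := fun h => ha (Fin.ext h)
  have hcard : ∑ j, adjEntry G (u a) j
      = (Finset.univ.filter fun j => G s(u a, j) = true).card := by
    simp [adjEntry]
  have heq : (Finset.univ.filter fun j => G s(u a, j) = true)
      = (Finset.univ.filter fun b : Fin (m + 2) => (b : ℕ) = a + 1 ∨ (a : ℕ) = b + 1).image u := by
    ext y
    simp only [Finset.mem_filter, Finset.mem_univ, true_and, Finset.mem_image,
      edge_iff_of_mem_whiskerEvent hu hG ha]
    constructor
    · rintro ⟨b, rfl, hb⟩
      exact ⟨b, hb, rfl⟩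
    · rintro ⟨b, hb, rfl⟩
      exact ⟨b, rfl, hb⟩
  rw [hcard, heq, Finset.card_image_of_injective _ hu]
  constructor
  · refine Finset.card_pos.2 ⟨⟨a - 1, by omega⟩, ?_⟩
    simp
    omega
  · rw [← Finset.card_image_of_injective _ Fin.val_injective]
    refine (Finset.card_le_card (t := {(a : ℕ) + 1, (a : ℕ) - 1}) ?_).trans Finset.card_le_two
    intro k hk
    obtain ⟨b, hb, rfl⟩ := Finset.mem_image.1 hk
    have := (Finset.mem_filter.1 hb).2
    simp
    omega

lemma volumeOf_pathBody_bounds {n m : ℕ} {u : Fin (m + 2) → Fin n}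
    (hu : Function.Injective u) {G : EdgeConfig n} (hG : G ∈ whiskerEvent u) :
    m + 1 ≤ volumeOf G (pathBody u) ∧ volumeOf G (pathBody u) ≤ 2 * (m + 1) := by
  rw [← card_pathBody hu, mul_comm, ← smul_eq_mul]
  refine ⟨?_, Finset.sum_le_card_nsmul _ _ _
    fun x hx => (degree_pathBody_bounds hu hG hx).2⟩
  have := Finset.card_nsmul_le_sum (pathBody u) (fun x => ∑ j, adjEntry G x j) 1
    fun x hx => (degree_pathBody_bounds hu hG hx).1
  simpa [volumeOf] using this

lemma isConnectedSet_pathBody {n m : ℕ} {u : Fin (m + 2) → Fin n}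
    (hu : Function.Injective u) {G : EdgeConfig n} (hG : G ∈ whiskerEvent u) :
    IsConnectedSet G (pathBody u) := by
  have h10 : (1 : Fin (m + 2)) ≠ 0 := by simp
  unfold IsConnectedSet
  rw [SimpleGraph.connected_iff_exists_forall_reachable]
  refine ⟨⟨u 1, mem_pathBody h10⟩, ?_⟩
  have key : ∀ k (hk : k + 1 < m + 2),
      ((underlyingGraph G).induce (pathBody u : Set (Fin n))).Reachable ⟨u 1, mem_pathBody h10⟩
        ⟨u ⟨k + 1, hk⟩, mem_pathBody (fun h => by simpa using congrArg Fin.val h)⟩ := by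
    intro k
    induction k with
    | zero => exact fun hk => SimpleGraph.Reachable.refl _
    | succ k ih =>
      intro hk
      refine (ih (by omega)).trans (SimpleGraph.Adj.reachable ?_)
      change (underlyingGraph G).Adj (u _) (u _)
      rw [underlyingGraph, SimpleGraph.fromEdgeSet_adj]
      refine ⟨?_, fun h => by simpa using congrArg Fin.val (hu h)⟩
      exact (edge_iff_of_mem_whiskerEvent hu hG
        (fun h => by simpa using congrArg Fin.val h) _).2 ⟨_, rfl, Or.inl rfl⟩
  rintro ⟨x, hx⟩
  obtain ⟨⟨a, ha⟩, ha0, rfl⟩ := mem_pathBody_iff.1 hx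
  obtain ⟨k, rfl⟩ : ∃ k, a = k + 1 :=
    ⟨a - 1, by have : a ≠ 0 := fun h => ha0 (Fin.ext h); omega⟩
  exact key k ha

/-- Two hanging paths that occur in the same graph and share a node of their bodies coincide:
walking down from the common node one never leaves the first body before the anchor, so both
have the same anchor edge, and from there on the next node is determined. -/
lemma HangingPath.eq_of_not_disjoint {n m : ℕ} (u v : HangingPath n m) {G : EdgeConfig n}
    (hu : G ∈ whiskerEvent u.1) (hv : G ∈ whiskerEvent v.1)
    (h : ¬ Disjoint (pathBody u.1) (pathBody v.1)) : u = v := by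
  obtain ⟨u, hui, hu0, hus⟩ := u
  obtain ⟨v, hvi, hv0, hvs⟩ := v
  dsimp only at hu hv h
  have hsucc : ∀ {k} (hk : k + 1 < m + 2), (⟨k + 1, hk⟩ : Fin (m + 2)) ≠ 0 :=
    fun hk h => by simpa using congrArg Fin.val h
  have hul : ∀ {a : Fin (m + 2)}, a ≠ 0 → n ≤ 2 * (u a : ℕ) := by
    intro a ha
    obtain ⟨i, rfl⟩ := Fin.exists_succ_eq.2 ha
    exact hus i
  have hvl : ∀ {a : Fin (m + 2)}, a ≠ 0 → n ≤ 2 * (v a : ℕ) := by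
    intro a ha
    obtain ⟨i, rfl⟩ := Fin.exists_succ_eq.2 ha
    exact hvs i
  have hdown : ∀ k (hk : k + 1 < m + 2), v ⟨k + 1, hk⟩ ∈ pathBody u →
      v ⟨1, by omega⟩ ∈ pathBody u := by
    intro k
    induction k with
    | zero => exact fun _ h => h
    | succ k ih =>
      intro hk hmem
      refine ih (by omega) ?_
      have he : G s(v ⟨k + 1 + 1, hk⟩, v ⟨k + 1, by omega⟩) = true :=
        (edge_iff_of_mem_whiskerEvent hvi hv (hsucc _) _).2 ⟨_, rfl, Or.inr rfl⟩
      obtain ⟨a, ha, hax⟩ := mem_pathBody_iff.1 hmem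
      rw [← hax] at he
      obtain ⟨b, hb, _⟩ := (edge_iff_of_mem_whiskerEvent hui hu ha _).1 he
      rw [hb]
      refine mem_pathBody fun hb0 => ?_
      have h1 := hvl (hsucc (by omega : k + 1 < m + 2))
      rw [hb, hb0] at h1
      omega
  have h1 : v ⟨1, by omega⟩ ∈ pathBody u := by
    obtain ⟨x, hx1, hx2⟩ := Finset.not_disjoint_iff.1 h
    obtain ⟨⟨a, ha⟩, ha0, rfl⟩ := mem_pathBody_iff.1 hx2
    obtain ⟨k, rfl⟩ : ∃ k, a = k + 1 :=
      ⟨a - 1, by have : a ≠ 0 := fun h => ha0 (Fin.ext h); omega⟩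
    exact hdown k ha hx1
  have hstart : v 0 = u 0 ∧ v ⟨1, by omega⟩ = u ⟨1, by omega⟩ := by
    have he : G s(v ⟨1, by omega⟩, v 0) = true :=
      (edge_iff_of_mem_whiskerEvent hvi hv (hsucc _) _).2 ⟨0, rfl, Or.inr rfl⟩
    obtain ⟨a, ha, hax⟩ := mem_pathBody_iff.1 h1
    rw [← hax] at he
    obtain ⟨b, hb, hab⟩ := (edge_iff_of_mem_whiskerEvent hui hu ha _).1 he
    have hb0 : b = 0 := by
      by_contra hb0
      have h2 := hul hb0
      rw [← hb] at h2
      omega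
    subst hb0
    refine ⟨hb, hax ▸ congrArg u (Fin.ext ?_)⟩
    simpa using hab
  have hall : ∀ k (hk : k < m + 2), v ⟨k, hk⟩ = u ⟨k, hk⟩ := by
    intro k
    induction k using Nat.strong_induction_on with
    | _ k ih =>
      intro hk
      match k, ih, hk with
      | 0, _, _ => exact hstart.1
      | 1, _, _ => exact hstart.2
      | k + 2, ih, hk =>
        have he : G s(v ⟨k + 1, by omega⟩, v ⟨k + 2, hk⟩) = true :=
          (edge_iff_of_mem_whiskerEvent hvi hv (hsucc _) _).2 ⟨_, rfl, Or.inl rfl⟩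
        rw [ih (k + 1) (by omega) (by omega)] at he
        obtain ⟨b, hb, hab⟩ := (edge_iff_of_mem_whiskerEvent hui hu (hsucc _) _).1 he
        rw [hb]
        rcases hab with hab | hab
        · exact congrArg u (Fin.ext hab)
        · exfalso
          have hbk : b = ⟨k, by omega⟩ := Fin.ext (by
            change (b : ℕ) = k
            simp at hab
            omega)
          rw [hbk, ← ih k (by omega) (by omega)] at hb
          have := congrArg Fin.val (hvi hb)
          simp at this
  exact Subtype.ext (funext fun a => (hall a a.2).symm)

/-- Two different hanging paths in one graph make the first one a whisker of conductance of order
`1 / m`: the volume of the complement is bounded below by that of the other body. -/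
lemma HangingPath.exists_isWhisker {n m : ℕ} {u v : HangingPath n m} (huv : u ≠ v)
    {G : EdgeConfig n} (hu : G ∈ whiskerEvent u.1) (hv : G ∈ whiskerEvent v.1) :
    ∃ S : Finset (Fin n), IsWhisker G S ∧ S.card = m + 1 ∧
      1 / (2 * (m + 1 : ℝ)) ≤ conductance G S ∧ conductance G S ≤ 1 / (m + 1 : ℝ) := by
  have hdisj : Disjoint (pathBody u.1) (pathBody v.1) := by
    by_contra h
    exact huv (u.eq_of_not_disjoint v hu hv h)
  have hcut := cutSize_pathBody u.2.1 hu
  obtain ⟨h1, h2⟩ := volumeOf_pathBody_bounds u.2.1 hu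
  obtain ⟨h3, _⟩ := volumeOf_pathBody_bounds v.2.1 hv
  have h4 : volumeOf G (pathBody v.1) ≤ volumeOf G (pathBody u.1)ᶜ :=
    Finset.sum_le_sum_of_subset fun x hx =>
      Finset.mem_compl.2 fun hx' => Finset.disjoint_left.1 hdisj hx' hx
  refine ⟨pathBody u.1, ⟨isConnectedSet_pathBody u.2.1 hu, hcut⟩, card_pathBody u.2.1, ?_, ?_⟩
  all_goals
    have h5 : m + 1 ≤ min (volumeOf G (pathBody u.1)) (volumeOf G (pathBody u.1)ᶜ) :=
      le_min h1 (h3.trans h4)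
    have h6 : min (volumeOf G (pathBody u.1)) (volumeOf G (pathBody u.1)ᶜ) ≤ 2 * (m + 1) :=
      (min_le_left _ _).trans h2
    have h5' : ((m + 1 : ℕ) : ℝ)
        ≤ (min (volumeOf G (pathBody u.1)) (volumeOf G (pathBody u.1)ᶜ) : ℕ) := by
      exact_mod_cast h5
    have h6' : ((min (volumeOf G (pathBody u.1)) (volumeOf G (pathBody u.1)ᶜ) : ℕ) : ℝ)
        ≤ (2 * (m + 1) : ℕ) := by
      exact_mod_cast h6
    push_cast at h5' h6'
    rw [conductance, hcut, Nat.cast_one]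
    have hm : (0 : ℝ) < m + 1 := by positivity
  · push_cast
    exact one_div_le_one_div_of_le (hm.trans_le h5') h6'
  · push_cast
    exact one_div_le_one_div_of_le hm h5'

/-! ### The number of hanging paths -/

lemma sum_image_le_sum {ι κ : Type*} [DecidableEq κ] (s : Finset ι) (g : ι → κ) {f : κ → ℝ}
    (hf : ∀ k, 0 ≤ f k) : ∑ k ∈ s.image g, f k ≤ ∑ i ∈ s, f (g i) := by
  rw [← Finset.sum_fiberwise_of_maps_to (fun i hi => Finset.mem_image_of_mem g hi)]
  refine Finset.sum_le_sum fun k hk => ?_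
  obtain ⟨i, hi, rfl⟩ := Finset.mem_image.1 hk
  exact Finset.single_le_sum (f := fun i => f (g i)) (fun i _ => hf _)
    (Finset.mem_filter.2 ⟨hi, rfl⟩)

lemma sum_edgeProb_le_of_subset {n : ℕ} {w : Fin n → ℝ} (hw : ∀ i, 0 < w i)
    {T : Finset (Sym2 (Fin n))} {S S' : Finset (Fin n)}
    (hT : ∀ e ∈ T, ∃ i ∈ S, ∃ j ∈ S', e = s(i, j)) :
    ∑ e ∈ T, edgeProb w e ≤ (∑ i ∈ S, w i) * (∑ i ∈ S', w i) / ∑ k, w k := by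
  rw [← sum_sum_edgeProb, ← Finset.sum_product']
  refine le_trans (Finset.sum_le_sum_of_subset_of_nonneg ?_ fun e _ _ => edgeProb_nonneg hw e)
    (sum_image_le_sum (S ×ˢ S') (fun p : Fin n × Fin n => s(p.1, p.2)) (edgeProb_nonneg hw))
  intro e he
  obtain ⟨i, hi, j, hj, rfl⟩ := hT e he
  exact Finset.mem_image.2 ⟨(i, j), Finset.mk_mem_product hi hj, rfl⟩

lemma HangingPath.sum_pathBody_le {n m : ℕ} (u : HangingPath n m) {w : Fin n → ℝ} {K : ℝ}
    (hK : ∀ j : Fin n, n ≤ 2 * (j : ℕ) → w j ≤ K) :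
    ∑ i ∈ pathBody u.1, w i ≤ K * (m + 1) := by
  have h := Finset.sum_le_card_nsmul (pathBody u.1) w K fun x hx => by
    obtain ⟨i, _, rfl⟩ := Finset.mem_image.1 hx
    exact hK _ (u.2.2.2 i)
  rw [card_pathBody u.2.1, nsmul_eq_mul] at h
  push_cast at h
  linarith

lemma HangingPath.edgeProb_le_half {n m : ℕ} (u : HangingPath n m) {w : Fin n → ℝ} {K : ℝ}
    (hw : ∀ i, 0 < w i) (hw2 : ∀ i, w i ^ 2 < ∑ k, w k)
    (hK : ∀ j : Fin n, n ≤ 2 * (j : ℕ) → w j ≤ K) (hKW : 4 * K ^ 2 ≤ ∑ k, w k)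
    {e : Sym2 (Fin n)} (he : e ∈ touchingPairs (pathBody u.1)) : edgeProb w e ≤ 1 / 2 := by
  obtain ⟨_, x, hx, hxe⟩ := Finset.mem_filter.1 he
  obtain ⟨y, rfl⟩ := Sym2.mem_iff_exists.1 hxe
  have hxK : w x ≤ K := by
    obtain ⟨i, _, rfl⟩ := Finset.mem_image.1 hx
    exact hK _ (u.2.2.2 i)
  have hW : 0 < ∑ k, w k := lt_of_le_of_lt (sq_nonneg _) (hw2 x)
  rw [edgeProb_mk, div_le_iff₀ hW]
  have hx2 : 4 * w x ^ 2 ≤ ∑ k, w k := by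
    nlinarith [hw x]
  nlinarith [hw2 y, sq_nonneg (2 * w x - w y)]

/-- A lower bound for the probability of a single hanging path: each of its `m + 1` edges has
probability at least `l ^ 2 / (C * n)`, and the expected number of edges at its body is at most
`K * (m + 1)`. -/
lemma HangingPath.le_measureReal_whiskerEvent {n m : ℕ} (u : HangingPath n m) {w : Fin n → ℝ}
    {l K C : ℝ} (hl : 0 < l) (hwl : ∀ i, l ≤ w i) (hw2 : ∀ i, w i ^ 2 < ∑ k, w k)
    (hK : ∀ j : Fin n, n ≤ 2 * (j : ℕ) → w j ≤ K) (hKW : 4 * K ^ 2 ≤ ∑ k, w k)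
    (hC : ∑ k, w k ≤ C * n) :
    (l ^ 2 / (C * n) * Real.exp (-(2 * K))) ^ (m + 1)
      ≤ (expectedDegreeGraph w).real (whiskerEvent u.1) := by
  have hw : ∀ i, 0 < w i := fun i => hl.trans_le (hwl i)
  have hW : 0 < ∑ k, w k := lt_of_le_of_lt (sq_nonneg _) (hw2 (u.1 0))
  have hFT : pathEdges u.1 ⊆ touchingPairs (pathBody u.1) := by
    intro e he
    obtain ⟨i, _, rfl⟩ := Finset.mem_image.1 he
    exact Finset.mem_filter.2 ⟨Finset.mem_univ _, _,
      Finset.mem_image_of_mem _ (Finset.mem_univ i), Sym2.mem_mk_right _ _⟩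
  rw [whiskerEvent, measureReal_patternEvent hw hw2]
  have h1 : (l ^ 2 / (C * n)) ^ (m + 1) ≤ ∏ e ∈ pathEdges u.1, edgeProb w e := by
    have hcard : (l ^ 2 / (C * n)) ^ (m + 1) = ∏ _e ∈ pathEdges u.1, l ^ 2 / (C * n) := by
      rw [Finset.prod_const, card_pathEdges u.2.1]
    have hCn : 0 < C * n := hW.trans_le hC
    rw [hcard]
    refine Finset.prod_le_prod (fun _ _ => by positivity) fun e _ => ?_
    induction e with
    | _ a b =>
      rw [edgeProb_mk]
      refine div_le_div₀ (mul_pos (hw a) (hw b)).le ?_ hW hC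
      rw [sq]
      exact mul_le_mul (hwl a) (hwl b) hl.le (hw a).le
  have h2 : Real.exp (-(2 * (K * (m + 1))))
      ≤ ∏ e ∈ touchingPairs (pathBody u.1), (1 - edgeProb w e) := by
    refine exp_neg_two_mul_sum_le_prod _ (fun e _ => edgeProb_nonneg hw e)
      (fun e he => u.edgeProb_le_half hw hw2 hK hKW he) ?_
    refine (sum_edgeProb_le_of_subset hw (S := pathBody u.1) (S' := Finset.univ) ?_).trans ?_
    · intro e he
      obtain ⟨_, x, hx, hxe⟩ := Finset.mem_filter.1 he
      obtain ⟨y, rfl⟩ := Sym2.mem_iff_exists.1 hxe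
      exact ⟨x, hx, y, Finset.mem_univ _, rfl⟩
    · rw [mul_div_assoc, div_self hW.ne', mul_one]
      exact u.sum_pathBody_le hK
  have h3 : Real.exp (-(2 * (K * (m + 1)))) = Real.exp (-(2 * K)) ^ (m + 1) := by
    rw [← Real.exp_nat_mul]
    congr 1
    push_cast
    ring
  rw [mul_pow, ← h3]
  calc _ ≤ (∏ e ∈ pathEdges u.1, edgeProb w e)
          * ∏ e ∈ touchingPairs (pathBody u.1), (1 - edgeProb w e) := by
        refine mul_le_mul h1 h2 (Real.exp_pos _).le
          (Finset.prod_nonneg fun e _ => edgeProb_nonneg hw e)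
    _ ≤ _ := by
        rw [← Finset.inter_eq_right.2 hFT, ← Finset.prod_ite_mem, ← Finset.prod_mul_distrib]
        refine Finset.prod_le_prod (fun e _ => ?_) fun e _ => ?_
        · have := edgeProb_nonneg hw e
          have := edgeProb_le_one hw2 e
          refine mul_nonneg ?_ (by linarith)
          split_ifs <;> linarith
        · have := edgeProb_nonneg hw e
          have := edgeProb_le_one hw2 e
          by_cases he : e ∈ pathEdges u.1
          · simp [he, Finset.inter_eq_right.2 hFT]
            nlinarith
          · simp [he, Finset.inter_eq_right.2 hFT]

lemma HangingPath.measureReal_inter_le {n m : ℕ} {u v : HangingPath n m} (huv : u ≠ v)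
    {w : Fin n → ℝ} {K : ℝ} (hw : ∀ i, 0 < w i) (hw2 : ∀ i, w i ^ 2 < ∑ k, w k)
    (hK : ∀ j : Fin n, n ≤ 2 * (j : ℕ) → w j ≤ K) (hKW : 4 * K ^ 2 ≤ ∑ k, w k) :
    (expectedDegreeGraph w).real (whiskerEvent u.1 ∩ whiskerEvent v.1)
      ≤ Real.exp (2 * ((K * (m + 1)) ^ 2 / ∑ k, w k))
        * ((expectedDegreeGraph w).real (whiskerEvent u.1)
          * (expectedDegreeGraph w).real (whiskerEvent v.1)) := by
  by_cases hdisj : Disjoint (pathBody u.1) (pathBody v.1)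
  · have hW : 0 < ∑ k, w k := lt_of_le_of_lt (sq_nonneg _) (hw2 (u.1 0))
    have hdis : ∀ u v : HangingPath n m, Disjoint (pathBody u.1) (pathBody v.1) →
        Disjoint (touchingPairs (pathBody u.1)) (pathEdges v.1) := by
      intro u v h
      rw [Finset.disjoint_left]
      intro e he he'
      obtain ⟨_, x, hx, hxe⟩ := Finset.mem_filter.1 he
      obtain ⟨a, b, _, rfl⟩ := mem_pathEdges_iff.1 he'
      have key : ∀ c, x ≠ v.1 c := by
        rintro c rfl
        by_cases hc : c = 0
        · obtain ⟨i, _, hi⟩ := Finset.mem_image.1 hx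
          have h1 := u.2.2.2 i
          have h2 := v.2.2.1
          rw [hi, hc] at h1
          omega
        · exact Finset.disjoint_left.1 h hx (mem_pathBody hc)
      rcases Sym2.mem_iff.1 hxe with h' | h'
      · exact key a h'
      · exact key b h'
    refine measureReal_patternEvent_inter_le hw hw2 (hdis u v hdisj) (hdis v u hdisj.symm)
      (fun e he => u.edgeProb_le_half hw hw2 hK hKW (Finset.mem_inter.1 he).1) ?_
    refine (sum_edgeProb_le_of_subset hw (S := pathBody u.1) (S' := pathBody v.1) ?_).trans ?_
    · intro e he
      obtain ⟨h1, h2⟩ := Finset.mem_inter.1 he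
      obtain ⟨_, x, hx, hxe⟩ := Finset.mem_filter.1 h1
      obtain ⟨_, y, hy, hye⟩ := Finset.mem_filter.1 h2
      have hxy : x ≠ y := by
        rintro rfl
        exact Finset.disjoint_left.1 hdisj hx hy
      exact ⟨x, hx, y, hy, (Sym2.mem_and_mem_iff hxy).1 ⟨hxe, hye⟩⟩
    · rw [sq]
      have h0 : ∀ S : Finset (Fin n), 0 ≤ ∑ i ∈ S, w i :=
        fun S => Finset.sum_nonneg fun i _ => (hw i).le
      gcongr
      · exact h0 _
      · exact (h0 _).trans (u.sum_pathBody_le hK)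
      · exact u.sum_pathBody_le hK
      · exact v.sum_pathBody_le hK
  · have : whiskerEvent u.1 ∩ whiskerEvent v.1 = ∅ := by
      rw [Set.eq_empty_iff_forall_notMem]
      rintro G ⟨h1, h2⟩
      exact huv (u.eq_of_not_disjoint v h1 h2 hdisj)
    rw [this, measureReal_empty]
    positivity

lemma HangingPath.le_card {n m : ℕ} (hm : 4 * (m + 1) ≤ n) :
    ((n : ℝ) / 4) * ((n : ℝ) / 4) ^ (m + 1) ≤ Fintype.card (HangingPath n m) := by
  classical
  set H := {j : Fin n // 2 * (j : ℕ) < n} with hH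
  set L := {j : Fin n // n ≤ 2 * (j : ℕ)} with hL
  have hinj : Fintype.card (H × (Fin (m + 1) ↪ L)) ≤ Fintype.card (HangingPath n m) := by
    refine Fintype.card_le_of_injective (fun p => ⟨Fin.cons p.1.1 fun i => (p.2 i).1, ?_, ?_, ?_⟩) ?_
    · rw [Fin.cons_injective_iff]
      refine ⟨?_, fun i j h => p.2.injective (Subtype.ext h)⟩
      rintro ⟨i, hi⟩
      have h1 := (p.2 i).2
      have h2 := p.1.2
      dsimp only at hi
      rw [hi] at h1
      omega
    · exact p.1.2
    · exact fun i => (p.2 i).2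
    · rintro ⟨h, f⟩ ⟨h', f'⟩ heq
      have h1 := congrArg Subtype.val heq
      dsimp only at h1
      obtain ⟨h2, h3⟩ := Fin.cons_inj.1 h1
      refine Prod.ext (Subtype.ext h2) (DFunLike.ext _ _ fun i => Subtype.ext (congrFun h3 i))
  have hHc : n ≤ 4 * Fintype.card H := by
    have h1 : Fintype.card (Fin (n / 2)) ≤ Fintype.card H :=
      Fintype.card_le_of_injective (fun i => ⟨⟨i, by omega⟩, by dsimp only; omega⟩)
        fun i j h => Fin.ext (congrArg (fun x : H => (x.1 : ℕ)) h)
    rw [Fintype.card_fin] at h1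
    omega
  have hLc : n ≤ 4 * (Fintype.card L + 1 - (m + 1)) := by
    have h1 : Fintype.card (Fin (n / 2)) ≤ Fintype.card L :=
      Fintype.card_le_of_injective (fun i => ⟨⟨n - 1 - i, by omega⟩, by dsimp only; omega⟩)
        fun i j h => Fin.ext (by
          have := congrArg (fun x : L => (x.1 : ℕ)) h
          dsimp only at this
          omega)
    rw [Fintype.card_fin] at h1
    omega
  rw [Fintype.card_prod, Fintype.card_embedding_eq, Fintype.card_fin] at hinj
  have h2 := Nat.pow_sub_le_descFactorial (Fintype.card L) (m + 1)
  calc ((n : ℝ) / 4) * ((n : ℝ) / 4) ^ (m + 1)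
      ≤ (Fintype.card H : ℝ) * ((Fintype.card L + 1 - (m + 1) : ℕ) : ℝ) ^ (m + 1) := by
        have e1 : (n : ℝ) / 4 ≤ Fintype.card H := by
          rw [div_le_iff₀ (by norm_num), mul_comm]
          exact_mod_cast hHc
        have e2 : (n : ℝ) / 4 ≤ (Fintype.card L + 1 - (m + 1) : ℕ) := by
          rw [div_le_iff₀ (by norm_num), mul_comm]
          exact_mod_cast hLc
        gcongr
    _ ≤ _ := by
        exact_mod_cast (Nat.mul_le_mul_left _ h2).trans hinj

/-! ### Whiskers of logarithmic size, and the conclusion -/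

/-- The probability that no whisker of size `m + 1` and conductance of order `1 / m` exists. -/
lemma measureReal_not_exists_isWhisker_le {n m : ℕ} {w : Fin n → ℝ} {l K C Λ s : ℝ}
    (hl : 0 < l) (hwl : ∀ i, l ≤ w i) (hw2 : ∀ i, w i ^ 2 < ∑ k, w k)
    (hK : ∀ j : Fin n, n ≤ 2 * (j : ℕ) → w j ≤ K) (hKW : 4 * K ^ 2 ≤ ∑ k, w k)
    (hC0 : 0 < C) (hC : ∑ k, w k ≤ C * n) (hm : 4 * (m + 1) ≤ n) (hΛ2 : 2 ≤ Λ)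
    (hΛ : Λ ≤ n / 4 * (l ^ 2 / (4 * C) * Real.exp (-(2 * K))) ^ (m + 1))
    (hs : (K * (m + 1)) ^ 2 / ∑ k, w k ≤ s) (hs0 : 0 ≤ s) :
    (expectedDegreeGraph w).real {G | ¬ ∃ S : Finset (Fin n), IsWhisker G S ∧ S.card = m + 1 ∧
      1 / (2 * (m + 1 : ℝ)) ≤ conductance G S ∧ conductance G S ≤ 1 / (m + 1 : ℝ)}
      ≤ 4 / Λ + 4 * (Real.exp (2 * s) - 1) := by
  have hw : ∀ i, 0 < w i := fun i => hl.trans_le (hwl i)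
  have hn : 0 < (n : ℝ) := by
    have : 0 < n := by omega
    exact_mod_cast this
  have hΛ' : Λ ≤ ∑ u : HangingPath n m, (expectedDegreeGraph w).real (whiskerEvent u.1) := by
    calc Λ ≤ n / 4 * (n / 4) ^ (m + 1)
          * (l ^ 2 / (C * n) * Real.exp (-(2 * K))) ^ (m + 1) := by
          refine hΛ.trans (le_of_eq ?_)
          rw [mul_assoc, ← mul_pow]
          congr 2
          field_simp
      _ ≤ Fintype.card (HangingPath n m)
          * (l ^ 2 / (C * n) * Real.exp (-(2 * K))) ^ (m + 1) := by
          gcongr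
          exact HangingPath.le_card hm
      _ = ∑ _u : HangingPath n m, (l ^ 2 / (C * n) * Real.exp (-(2 * K))) ^ (m + 1) := by
          simp
      _ ≤ _ := Finset.sum_le_sum fun u _ =>
          u.le_measureReal_whiskerEvent hl hwl hw2 hK hKW hC
  refine le_trans (measureReal_mono ?_) (measureReal_forall_eq_le (expectedDegreeGraph w)
    (fun u : HangingPath n m => whiskerEvent u.1) (Λ := Λ) (ζ := Real.exp (2 * s) - 1)
    (by linarith [Real.one_le_exp (x := 2 * s) (by positivity)]) hΛ' hΛ2 fun u v huv => ?_)
  · intro G hG u v hu hv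
    by_contra huv
    exact hG (HangingPath.exists_isWhisker huv hu hv)
  · refine (HangingPath.measureReal_inter_le huv hw hw2 hK hKW).trans ?_
    rw [add_sub_cancel]
    gcongr

theorem mainTheorem1 (β w : ℝ) (hβ : 2 < β) (hβ' : β < 3) (hw : 5.88 < w) :
    ∃ a₁ a₂ b₁ b₂ c' ε : ℝ,
      0 < a₁ ∧ 0 < a₂ ∧ 0 < b₁ ∧ 0 < b₂ ∧ 0 < c' ∧ 0 < ε ∧
      ∀ wmax : ℕ → ℝ, Tendsto wmax atTop atTop →
        (∀ᶠ n in atTop, ∀ i : Fin n,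
          powerLawWeight β w (wmax n) n i ^ 2 < ∑ k, powerLawWeight β w (wmax n) n k) →
        Tendsto
          (fun n : ℕ => expectedDegreeGraph (powerLawWeight β w (wmax n) n)
            {G : EdgeConfig n |
              (∃ S : Finset (Fin n), IsWhisker G S ∧
                a₁ * Real.log n ≤ (S.card : ℝ) ∧ (S.card : ℝ) ≤ a₂ * Real.log n ∧
                b₁ / Real.log n ≤ conductance G S ∧ conductance G S ≤ b₂ / Real.log n) ∧
              (∀ S : Finset (Fin n), IsConnectedSet G S →
                c' * Real.log n < (S.card : ℝ) →
                2 * volumeOf G S ≤ volumeOf G Finset.univ →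
                ε ≤ conductance G S)})
          atTop (𝓝 1) := by
  obtain ⟨l, K, C, hl, hK, hC, hbounds⟩ := eventually_powerLawWeight_bounds β w hβ hw
  -- The expected number of hanging paths with `q` body nodes is at least `n / 4 * c₀ ^ q`; for
  -- `q` close to `a * log n` this is at least of order `√n`.
  set c₀ := l ^ 2 / (4 * C) * Real.exp (-(2 * K)) with hc₀
  have hc₀0 : 0 < c₀ := by positivity
  set D := max 1 (-Real.log c₀) with hD
  have hD0 : 0 < D := lt_of_lt_of_le one_pos (le_max_left _ _)
  have hc₀D : Real.exp (-D) ≤ c₀ := by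
    rw [← Real.le_log_iff_exp_le hc₀0]
    linarith [le_max_right 1 (-Real.log c₀)]
  set a := 1 / (2 * D) with ha
  have ha0 : 0 < a := by positivity
  have hε := lowCutRatio_pos
  refine ⟨a, a + 1, 1 / (2 * (a + 1)), 1 / a, 5, lowCutRatio / (1 + lowCutRatio), ha0,
    by positivity, by positivity, by positivity, by norm_num, by positivity,
    fun wmax hmax hsq => ?_⟩
  set Λ : ℕ → ℝ := fun n => Real.exp (-D) / 4 * Real.exp (Real.log n / 2) with hΛ
  set s : ℕ → ℝ := fun n => K ^ 2 * (a + 1) ^ 2 / 5.88 * (Real.log n ^ 2 / n) with hs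
  have hlog : Tendsto (fun n : ℕ => Real.log n) atTop atTop :=
    Real.tendsto_log_atTop.comp tendsto_natCast_atTop_atTop
  have hlogpow : ∀ k : ℕ, Tendsto (fun n : ℕ => Real.log n ^ k / n) atTop (𝓝 0) := fun k =>
    ((Real.isLittleO_pow_log_id_atTop (n := k)).tendsto_div_nhds_zero).comp
      tendsto_natCast_atTop_atTop
  have hΛtop : Tendsto Λ atTop atTop :=
    (Real.tendsto_exp_atTop.comp (hlog.atTop_div_const two_pos)).const_mul_atTop (by positivity)
  have hs0 : Tendsto s atTop (𝓝 0) := by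
    simpa using (hlogpow 2).const_mul (K ^ 2 * (a + 1) ^ 2 / 5.88)
  set err : ℕ → ℝ := fun n => 4 / Λ n + 4 * (Real.exp (2 * s n) - 1)
    + (2 * (n : ℝ)⁻¹ + Real.exp (-0.15 * n)) with herr
  have herr0 : Tendsto err atTop (𝓝 0) := by
    have h1 : Tendsto (fun n => 4 / Λ n) atTop (𝓝 0) := hΛtop.const_div_atTop 4
    have h2 : Tendsto (fun n => 4 * (Real.exp (2 * s n) - 1)) atTop (𝓝 0) := by
      have := ((Real.continuous_exp.tendsto _).comp (hs0.const_mul 2)).sub_const 1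
      simpa using this.const_mul 4
    have h3 : Tendsto (fun n : ℕ => 2 * (n : ℝ)⁻¹) atTop (𝓝 0) := by
      simpa using (tendsto_inv_atTop_zero.comp
        (tendsto_natCast_atTop_atTop (R := ℝ))).const_mul 2
    have h4 : Tendsto (fun n : ℕ => Real.exp (-0.15 * n)) atTop (𝓝 0) :=
      Real.tendsto_exp_atBot.comp
        ((tendsto_natCast_atTop_atTop (R := ℝ)).const_mul_atTop_of_neg (by norm_num))
    simpa only [add_zero] using (h1.add h2).add (h3.add h4)
  have hmain : ∀ᶠ n : ℕ in atTop, 1 - err n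
      ≤ (expectedDegreeGraph (powerLawWeight β w (wmax n) n)).real {G : EdgeConfig n |
              (∃ S : Finset (Fin n), IsWhisker G S ∧
                a * Real.log n ≤ (S.card : ℝ) ∧ (S.card : ℝ) ≤ (a + 1) * Real.log n ∧
                1 / (2 * (a + 1)) / Real.log n ≤ conductance G S ∧
                conductance G S ≤ 1 / a / Real.log n) ∧
              (∀ S : Finset (Fin n), IsConnectedSet G S →
                5 * Real.log n < (S.card : ℝ) →
                2 * volumeOf G S ≤ volumeOf G Finset.univ →
                lowCutRatio / (1 + lowCutRatio) ≤ conductance G S)} := by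
    have hsmall : ∀ᶠ n : ℕ in atTop, Real.log n ^ 1 / n ≤ 1 / (4 * (a + 1)) :=
      (hlogpow 1).eventually_le_const (by positivity)
    filter_upwards [hbounds wmax hmax hsq, hsq, hlog.eventually_ge_atTop 1, hsmall,
      hΛtop.eventually_ge_atTop 2, eventually_ge_atTop 2,
      (tendsto_natCast_atTop_atTop (R := ℝ)).eventually_ge_atTop (4 * K ^ 2 / 5.88)]
      with n ⟨hwl, hwK, hW, hWC⟩ hw2 hlog1 hsmall hΛ2 hn2 hnK
    have hn0 : (0 : ℝ) < n := by positivity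
    have hlog0 : 0 < Real.log n := by linarith
    have hW0 : 0 < ∑ k, powerLawWeight β w (wmax n) n k := by linarith
    set m := ⌊a * Real.log n⌋₊ with hm
    have hm1 : a * Real.log n ≤ (m + 1 : ℝ) := (Nat.lt_floor_add_one _).le
    have hm2 : (m + 1 : ℝ) ≤ (a + 1) * Real.log n := by
      have := Nat.floor_le (show 0 ≤ a * Real.log n by positivity)
      linarith
    have hm3 : (m + 1 : ℝ) ≤ a * Real.log n + 1 := by
      linarith [Nat.floor_le (show 0 ≤ a * Real.log n by positivity)]
    have hmn : 4 * (m + 1) ≤ n := by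
      rw [pow_one, div_le_div_iff₀ hn0 (by positivity)] at hsmall
      have : (4 * (m + 1) : ℝ) ≤ n := by linarith
      exact_mod_cast this
    have hKW : 4 * K ^ 2 ≤ ∑ k, powerLawWeight β w (wmax n) n k := by
      rw [div_le_iff₀ (by norm_num)] at hnK
      linarith
    have hΛn : Λ n ≤ n / 4 * c₀ ^ (m + 1) := by
      calc Λ n = n / 4 * Real.exp (-(D * (a * Real.log n + 1))) := by
            have h1 : -(D * (a * Real.log n + 1)) = -D + (-Real.log n + Real.log n / 2) := by
              rw [ha]
              field_simp
              ring
            rw [h1, Real.exp_add, Real.exp_add, Real.exp_neg (Real.log n), Real.exp_log hn0]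
            simp only [hΛ]
            field_simp
        _ ≤ n / 4 * Real.exp (-D) ^ (m + 1) := by
            rw [← Real.exp_nat_mul]
            gcongr
            push_cast
            nlinarith
        _ ≤ _ := by gcongr
    have hsn : (K * (m + 1)) ^ 2 / ∑ k, powerLawWeight β w (wmax n) n k ≤ s n := by
      calc _ ≤ (K * ((a + 1) * Real.log n)) ^ 2 / (5.88 * n) := by gcongr
        _ = s n := by
            simp only [hs]
            field_simp
    have hwhisker := measureReal_not_exists_isWhisker_le hl hwl hw2 hwK hKW hC hWC hmn hΛ2 hΛn hsn
      (by simp only [hs]; positivity)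
    have hexp := measureReal_exists_conductance_lt_le hn2 (fun i => hl.trans_le (hwl i)) hw2 hW
    rw [sub_le_iff_le_add]
    refine le_trans ?_ ((measureReal_union_le _ _).trans
        (add_le_add le_rfl ((measureReal_union_le _ _).trans (add_le_add hwhisker hexp))))
    refine (probReal_univ (μ := expectedDegreeGraph
      (powerLawWeight β w (wmax n) n))).symm.le.trans (measureReal_mono ?_)
    intro G _
    by_cases h1 : ∃ S : Finset (Fin n), IsWhisker G S ∧ S.card = m + 1 ∧
      1 / (2 * (m + 1 : ℝ)) ≤ conductance G S ∧ conductance G S ≤ 1 / (m + 1 : ℝ)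
    · by_cases h2 : ∃ S, IsConnectedSet G S ∧ 5 * Real.log n < (S.card : ℝ) ∧
          2 * volumeOf G S ≤ volumeOf G Finset.univ ∧
          conductance G S < lowCutRatio / (1 + lowCutRatio)
      · exact Or.inr (Or.inr h2)
      · left
        obtain ⟨S, hS, hcard, hc1, hc2⟩ := h1
        have hcard' : (S.card : ℝ) = m + 1 := by
          rw [hcard]
          push_cast
          rfl
        refine ⟨⟨S, hS, by rwa [hcard'], by rwa [hcard'], le_trans ?_ hc1, hc2.trans ?_⟩, ?_⟩
        · rw [div_div]
          refine one_div_le_one_div_of_le (by positivity) ?_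
          linarith
        · rw [div_div]
          exact one_div_le_one_div_of_le (by positivity) hm1
        · intro S h3 h4 h5
          by_contra! h6
          exact h2 ⟨S, h3, h4, h5, h6⟩
    · exact Or.inr (Or.inl h1)
  have hreal := tendsto_of_tendsto_of_tendsto_of_le_of_le'
    (by simpa using herr0.const_sub 1) tendsto_const_nhds hmain
    (Eventually.of_forall fun n => measureReal_le_one)
  have hofReal := ENNReal.tendsto_ofReal hreal
  rw [ENNReal.ofReal_one] at hofReal
  exact hofReal.congr fun n => ofReal_measureReal
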